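/- Let $X$ be a Banach space of martingale type $s\in(1,2]$: there is a constant $C_{s,X}$ such that on every probability space every finite martingale difference sequence $(d_i)$ in $L^s(\Omega;X)$ satisfies $(\mathbb E\|\sum_i d_i\|^s)^{1/s}\le C_{s,X}(\sum_i\mathbb E\|d_i\|^s)^{1/s}$. Let $(\Omega,\mathscr F,\mathbb P)$ be a probability space, let $(J,\mathscr J,\nu)$ be a $\sigma$-finite measure space, and let $N$ be a Poisson random measure on $\mathbb R_+\times J$ with intensity measure $dt\times\nu$, that is, an $\overline{\mathbb N}$-valued random measure such that $N(D)$ is Poisson distributed with parameter $(dt\times\nu)(D)$ (and $N(D)=\infty$ a.s. if this is infinite) and $N(D_1),\dots,N(D_n)$ are independent for pairwise disjoint measurable $D_1,\dots,D_n$. For $(dt\times\nu)(D)<\infty$ put $\tilde N(D)=N(D)-(dt\times\nu)(D)$. Let $\mathscr F_t$ be the $\sigma$-algebra generated by the random variables $N((r,u]\times A)$, $0\le r<u\le t$, $A\in\mathscr J$. A simple, adapted $X$-valued process is a process of the form $$\phi=\sum_{i=1}^l\sum_{j=1}^m\sum_{k=1}^n F_{ijk}\,\mathbf 1_{(t_i,t_{i+1}]}\,\mathbf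 1_{A_j}\,x_{ijk},$$ where $0=t_1<\dots<t_{l+1}<\infty$, the sets $A_1,\dots,A_m\in\mathscr J$ are disjoint with $\nu(A_j)<\infty$, $F_{ijk}\in L^\infty(\Omega,\mathscr F_{t_i})$ and $x_{ijk}\in X$. For $t>0$ and $B\in\mathscr J$ its compensated Poisson integral is $$\int_{(0,t]\times B}\phi\,d\tilde N=\sum_{i,j,k}F_{ijk}\,\tilde N\big((t_i\wedge t,t_{i+1}\wedge t]\times(A_j\cap B)\big)\,x_{ijk}.$$ For $1\le p,q<\infty$ let $\mathscr D^p_{q,X}=L^p(\Omega;L^q(\mathbb R_+\times J;X))$, with norm $\|\phi\|_{\mathscr D^p_{q,X}}=\big(\mathbb E(\int_{\mathbb R_+\times J}\|\phi\|^q\,dt\,d\nu)^{p/q}\big)^{1/p}$. Put $\|\phi\|_{\mathscr D^p_{s,X}\cap\mathscr D^p_{p,X}}=\max\{\|\phi\|_{\mathscr D^p_{s,X}},\|\phi\|_{\mathscr D^p_{p,X}}\}$, and let $\|\phi\|_{\mathscr D^p_{s,X}+\mathscr D^p_{p,X}}$ be the infimum of $\|\phi_1\|_{\mathscr D^p_{s,X}}+\|\phi_2\|_{\mathscr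 D^p_{p,X}}$ over all decompositions $\phi=\phi_1+\phi_2$ with $\phi_1\in\mathscr D^p_{s,X}$ and $\phi_2\in\mathscr D^p_{p,X}$. (1) If $s\le p<\infty$, there is a constant $C$ depending only on $p,s,X$ such that, for all $\Omega,J,\nu,N$ as above, every simple, adapted $X$-valued process $\phi$ and every $B\in\mathscr J$, $$\Big(\mathbb E\sup_{t>0}\Big\|\int_{(0,t]\times B}\phi\,d\tilde N\Big\|_X^p\Big)^{1/p}\le C\,\|\phi\mathbf 1_B\|_{\mathscr D^p_{s,X}\cap\mathscr D^p_{p,X}}.$$ (2) If $1<p\le s$, there is a constant $C$ depending only on $p,s,X$ such that, for all $\Omega,J,\nu,N$ as above, every simple, adapted $X$-valued process $\phi$ and every $B\in\mathscr J$, $$\Big(\mathbb E\sup_{t>0}\Big\|\int_{(0,t]\times B}\phi\,d\tilde N\Big\|_X^p\Big)^{1/p}\le C\,\|\phi\mathbf 1_B\|_{\mathscr D^p_{s,X}+\mathscr D^p_{p,X}}.$$ -/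

import Mathlib

open MeasureTheory ProbabilityTheory
open scoped NNReal ENNReal

namespace PoissonIntegral

/-! ### Martingale type -/

/-- `d 0, d 1, …` is the difference sequence of an `X`-valued martingale with respect to `𝓕`
(the initial difference `d 0` is the initial value of the martingale). A finite martingale
difference sequence is an initial segment of such a sequence. -/
structure IsMartingaleDifference {Ω X : Type*} [NormedAddCommGroup X] [NormedSpace ℝ X]
    [CompleteSpace X] {m0 : MeasurableSpace Ω} (P : Measure Ω) (𝓕 : Filtration ℕ m0)
    (d : ℕ → Ω → X) : Prop where
  adapted : StronglyAdapted 𝓕 d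
  integrable : ∀ i, Integrable (d i) P
  condExp_eq_zero : ∀ i, P[d (i + 1) | 𝓕 i] =ᵐ[P] 0

/-- `X` has martingale type `s`: there is a constant `C` such that, on every probability space,
every finite martingale difference sequence in `L^s(Ω; X)` satisfies
`(𝔼 ‖∑ i, d i‖ ^ s) ^ (1 / s) ≤ C * (∑ i, 𝔼 ‖d i‖ ^ s) ^ (1 / s)`. -/
def HasMartingaleType.{v, u} (X : Type u) [NormedAddCommGroup X] [NormedSpace ℝ X]
    [CompleteSpace X] (s : ℝ) : Prop :=
  ∃ C : ℝ≥0, ∀ (Ω : Type v) [m0 : MeasurableSpace Ω] (P : Measure Ω) [IsProbabilityMeasure P]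
    (𝓕 : Filtration ℕ m0) (d : ℕ → Ω → X) (n : ℕ),
    IsMartingaleDifference P 𝓕 d → (∀ i, MemLp (d i) (ENNReal.ofReal s) P) →
      (∫⁻ ω, ‖∑ i ∈ Finset.range n, d i ω‖ₑ ^ s ∂P) ^ (1 / s) ≤
        C * (∑ i ∈ Finset.range n, ∫⁻ ω, ‖d i ω‖ₑ ^ s ∂P) ^ (1 / s)

/-! ### Poisson random measures -/

/-- `N` is an integer-valued random measure on `E` that is Poisson with `σ`-finite intensity
measure `μ`. -/
structure IsPoissonRandomMeasure {Ω E : Type*} [MeasurableSpace Ω] [MeasurableSpace E]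
    (N : Ω → Measure E) (μ : Measure E) (P : Measure Ω) : Prop where
  /-- every value is a natural number or `∞` -/
  integer_valued : ∀ ω B, MeasurableSet B → ∃ k : ℕ∞, N ω B = (k : ℝ≥0∞)
  measurable : ∀ B, MeasurableSet B → Measurable fun ω => N ω B
  sigmaFinite : SigmaFinite μ
  intensity : ∀ B, MeasurableSet B → ∫⁻ ω, N ω B ∂P = μ B
  /-- `N(B)` is Poisson distributed with parameter `μ B` if this is finite -/
  poisson : ∀ B, MeasurableSet B → μ B < ∞ →
    P.map (fun ω => N ω B) = (poissonMeasure (μ B).toNNReal).map (fun k : ℕ => (k : ℝ≥0∞))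
  /-- `N(B) = ∞` almost surely if `μ B = ∞` -/
  poisson_top : ∀ B, MeasurableSet B → μ B = ∞ → ∀ᵐ ω ∂P, N ω B = ∞
  indep : ∀ (n : ℕ) (B : Fin n → Set E), (∀ i, MeasurableSet (B i)) →
    Pairwise (Function.onFun Disjoint B) → iIndepFun (fun i ω => N ω (B i)) P

/-- The compensated random measure `Ñ(B) = N(B) - μ(B)`, meaningful for `μ B < ∞`. -/
noncomputable def compensated {Ω E : Type*} [MeasurableSpace E] (N : Ω → Measure E)
    (μ : Measure E) (B : Set E) (ω : Ω) : ℝ :=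
  (N ω B).toReal - (μ B).toReal

/-- Lebesgue measure on `ℝ₊`. -/
noncomputable def timeMeasure : Measure ℝ≥0 :=
  (volume : Measure ℝ).comap (fun t : ℝ≥0 => (t : ℝ))

/-- The measure `dt × ν` on `ℝ₊ × J`. -/
noncomputable def timeProd {J : Type*} [MeasurableSpace J] (ν : Measure J) : Measure (ℝ≥0 × J) :=
  timeMeasure.prod ν

/-- The `σ`-algebra `𝓕_t` generated by the random variables `N((r, u] × A)`,
`0 ≤ r < u ≤ t`, `A` measurable. -/
abbrev poissonSigma {Ω J : Type*} [MeasurableSpace J] (N : Ω → Measure (ℝ≥0 × J)) (t : ℝ≥0) :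
    MeasurableSpace Ω :=
  ⨆ (r : ℝ≥0) (u : ℝ≥0) (A : Set J) (_ : r < u) (_ : u ≤ t) (_ : MeasurableSet A),
    MeasurableSpace.comap (fun ω => N ω (Set.Ioc r u ×ˢ A)) inferInstance

/-! ### Simple adapted processes and their stochastic integrals -/

/-- The data of a simple, adapted `X`-valued process
`∑ i j k, F i j k • 1_{(t i, t (i + 1)]} 1_{A j} x i j k` with coefficients
`F i j k ∈ L^∞(Ω, 𝓕_{t i})`. -/
structure SimpleProcess (𝕜 X : Type*) [RCLike 𝕜] {Ω J : Type*} [MeasurableSpace Ω]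
    [MeasurableSpace J] (P : Measure Ω) (ν : Measure J) (N : Ω → Measure (ℝ≥0 × J)) where
  l : ℕ
  m : ℕ
  n : ℕ
  t : Fin (l + 1) → ℝ≥0
  t_zero : t 0 = 0
  t_strictMono : StrictMono t
  F : Fin l → Fin m → Fin n → Ω → 𝕜
  F_memLp : ∀ i j k, MemLp (F i j k) ∞ P
  F_adapted : ∀ i j k, AEStronglyMeasurable[poissonSigma N (t i.castSucc)] (F i j k) P
  A : Fin m → Set J
  A_measurable : ∀ j, MeasurableSet (A j)
  A_finite : ∀ j, ν (A j) < ∞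
  A_disjoint : Pairwise (Function.onFun Disjoint A)
  x : Fin l → Fin m → Fin n → X

namespace SimpleProcess

variable {𝕜 X : Type*} [RCLike 𝕜] [NormedAddCommGroup X] [NormedSpace 𝕜 X] {Ω J : Type*}
  [MeasurableSpace Ω] [MeasurableSpace J] {P : Measure Ω} {ν : Measure J}
  {N : Ω → Measure (ℝ≥0 × J)}

/-- The process `φ : Ω × ℝ₊ × J → X` given by the data. -/
noncomputable def toFun (φ : SimpleProcess 𝕜 X P ν N) (ω : Ω) (z : ℝ≥0 × J) : X :=
  ∑ i, ∑ j, ∑ k,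
    (Set.Ioc (φ.t i.castSucc) (φ.t i.succ) ×ˢ φ.A j).indicator
      (fun _ => φ.F i j k ω • φ.x i j k) z

/-- The compensated Poisson stochastic integral `∫_{(0, t] × B} φ dÑ`. -/
noncomputable def integral (φ : SimpleProcess 𝕜 X P ν N) (B : Set J) (t : ℝ≥0) (ω : Ω) : X :=
  ∑ i, ∑ j, ∑ k,
    (φ.F i j k ω *
      ((compensated N (timeProd ν)
        (Set.Ioc (min (φ.t i.castSucc) t) (min (φ.t i.succ) t) ×ˢ (φ.A j ∩ B)) ω : ℝ) : 𝕜)) •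
      φ.x i j k

end SimpleProcess

/-- The process `φ 1_B`. -/
noncomputable def restrictJump {Ω J X : Type*} [Zero X] (φ : Ω → ℝ≥0 × J → X) (B : Set J) :
    Ω → ℝ≥0 × J → X :=
  fun ω => (Set.univ ×ˢ B).indicator (φ ω)

/-! ### The norms -/

/-- The norm of `L^p(Ω; L^q(ℝ₊ × J; X))`, as an extended nonnegative real number. -/
noncomputable def mixedNorm {Ω J X : Type*} [MeasurableSpace Ω] [MeasurableSpace J]
    [NormedAddCommGroup X] (P : Measure Ω) (ν : Measure J) (q p : ℝ)
    (φ : Ω → ℝ≥0 × J → X) : ℝ≥0∞ :=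
  (∫⁻ ω, (∫⁻ z, ‖φ ω z‖ₑ ^ q ∂(timeProd ν)) ^ (p / q) ∂P) ^ (1 / p)

/-- The norm of `L^p(Ω; L^s(ℝ₊ × J; X)) ∩ L^p(Ω; L^p(ℝ₊ × J; X))`. -/
noncomputable def interNorm {Ω J X : Type*} [MeasurableSpace Ω] [MeasurableSpace J]
    [NormedAddCommGroup X] (P : Measure Ω) (ν : Measure J) (s p : ℝ)
    (φ : Ω → ℝ≥0 × J → X) : ℝ≥0∞ :=
  max (mixedNorm P ν s p φ) (mixedNorm P ν p p φ)

/-- The norm of `L^p(Ω; L^s(ℝ₊ × J; X)) + L^p(Ω; L^p(ℝ₊ × J; X))`: the infimum of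
`‖φ₁‖ + ‖φ₂‖` over all decompositions `φ = φ₁ + φ₂` (almost everywhere) into strongly measurable
processes. Decompositions in which one of the summands has infinite norm do not contribute. -/
noncomputable def sumNorm {Ω J X : Type*} [MeasurableSpace Ω] [MeasurableSpace J]
    [NormedAddCommGroup X] (P : Measure Ω) (ν : Measure J) (s p : ℝ)
    (φ : Ω → ℝ≥0 × J → X) : ℝ≥0∞ :=
  ⨅ (φ₁ : Ω → ℝ≥0 × J → X) (φ₂ : Ω → ℝ≥0 × J → X)
    (_ : AEStronglyMeasurable (Function.uncurry φ₁) (P.prod (timeProd ν)))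
    (_ : AEStronglyMeasurable (Function.uncurry φ₂) (P.prod (timeProd ν)))
    (_ : Function.uncurry φ =ᵐ[P.prod (timeProd ν)]
      Function.uncurry φ₁ + Function.uncurry φ₂),
    mixedNorm P ν s p φ₁ + mixedNorm P ν p p φ₂

end PoissonIntegral

universe u v w k

/-! Discretize. Refine the jump times of `φ` to a grid and cut its support into disjoint cells `D k`
of intensity `a k ≤ 1`. At grid times the integral is a sum `∑ η k • ξ k`, where `η k` is the
compensated mass of `D k` and `ξ k` is the value of `φ` there. The variable `η k` is centred and
independent of the past that determines `ξ k`, so the sum is a martingale. For small intensity all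
Poisson moments are linear in it: `𝔼|η k|^r ≤ c_r a k` for `r ≥ 1`. Hence `∑ a k ‖ξ k‖^q` is bounded
by `∫ ‖φ 1_B‖^q`, and the whole theorem reduces to bounds for the maximal function `M` of such
transforms. Right-continuity of the paths and monotone convergence then pass to the supremum over
all times (`exists_discretization`, `lintegral_iSup_integral_le`).

Martingale type enters through a weak-type bound for `M`, obtained by stopping at the first passage
and applying Chebyshev. Stopping always means multiplying `ξ k` by the indicator of an event of the
past.

For `p ≥ s`, a good-`λ` inequality compares `M` with the largest jump and with `(∑ a k ‖ξ
k‖^s)^(1/s)`. Since the latter is predictable, it can be stopped without overshoot. Integrating over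
levels and absorbing the small term gives `lintegral_maxTransform_rpow_le`.

For `1 < p < s`, split each `ξ k` at the level `t`, using the exponent `s` for small values and the
exponent `1` for large ones. This bounds `P(M > 2t)` by the mean of `min 1 (∑ a k Φ(‖ξ k‖/t))` with
`Φ x = min x (x^s)`. Only norms occur here, so a decomposition `φ 1_B = φ₁ + φ₂` can be inserted
pointwise even when its summands are not adapted. Integration over `t` gives the sum norm
(`lintegral_min_one_lintegral_minPow_le`). At `p = s` the first case and the triangle inequality
suffice. -/

namespace PoissonIntegral

/-! ### Transforms of independent noise by predictable sequences -/

/-- `C` is an admissible constant in the definition of martingale type `s`. -/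
def MartingaleTypeBound.{v', u'} (X : Type u') [NormedAddCommGroup X] [NormedSpace ℝ X]
    [CompleteSpace X] (s : ℝ) (C : ℝ≥0) : Prop :=
  ∀ (Ω : Type v') [m0 : MeasurableSpace Ω] (P : Measure Ω) [IsProbabilityMeasure P]
    (𝓕 : Filtration ℕ m0) (d : ℕ → Ω → X) (n : ℕ),
    IsMartingaleDifference P 𝓕 d → (∀ i, MemLp (d i) (ENNReal.ofReal s) P) →
      (∫⁻ ω, ‖∑ i ∈ Finset.range n, d i ω‖ₑ ^ s ∂P) ^ (1 / s) ≤
        C * (∑ i ∈ Finset.range n, ∫⁻ ω, ‖d i ω‖ₑ ^ s ∂P) ^ (1 / s)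

/-- A sequence of centred real random variables with all moments, adapted with a shift and
independent of the past. -/
structure IsNoise {Ω : Type*} {m0 : MeasurableSpace Ω} (𝓖 : Filtration ℕ m0) (η : ℕ → Ω → ℝ)
    (P : Measure Ω) : Prop where
  measurable : ∀ k, Measurable[𝓖 (k + 1)] (η k)
  indep : ∀ k, Indep (MeasurableSpace.comap (η k) inferInstance) (𝓖 k) P
  memLp : ∀ k (r : ℝ≥0∞), r ≠ ∞ → MemLp (η k) r P
  integral_eq_zero : ∀ k, ∫ ω, η k ω ∂P = 0

/-- A sequence of essentially bounded random vectors adapted to `𝓖`. -/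
structure IsBoundedAdapted {Ω X : Type*} [NormedAddCommGroup X] {m0 : MeasurableSpace Ω}
    (𝓖 : Filtration ℕ m0) (ξ : ℕ → Ω → X) (P : Measure Ω) : Prop where
  stronglyMeasurable : ∀ k, StronglyMeasurable[𝓖 k] (ξ k)
  memLp : ∀ k, MemLp (ξ k) ∞ P

/-- The transform `∑ k < n, η k • ξ k`. -/
def transform {Ω X : Type*} [NormedAddCommGroup X] [NormedSpace ℝ X] (η : ℕ → Ω → ℝ)
    (ξ : ℕ → Ω → X) (n : ℕ) (ω : Ω) : X :=
  ∑ k ∈ Finset.range n, η k ω • ξ k ω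

/-- The maximal function of the transform up to time `n`. -/
noncomputable def maxTransform {Ω X : Type*} [NormedAddCommGroup X] [NormedSpace ℝ X]
    (η : ℕ → Ω → ℝ) (ξ : ℕ → Ω → X) (n : ℕ) (ω : Ω) : ℝ≥0 :=
  (Finset.range (n + 1)).sup fun i => ‖transform η ξ i ω‖₊

variable {Ω : Type v} {X : Type u} [NormedAddCommGroup X] {m0 : MeasurableSpace Ω}
  {P : Measure Ω} {𝓖 : Filtration ℕ m0} {η : ℕ → Ω → ℝ} {ξ : ℕ → Ω → X}

/-- This replaces optional stopping: starting, stopping and truncating a transform are all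
multiplications of `ξ k` by events known at time `k`. -/
lemma IsBoundedAdapted.indicator (hξ : IsBoundedAdapted 𝓖 ξ P) {S : ℕ → Set Ω}
    (hS : ∀ k, MeasurableSet[𝓖 k] (S k)) :
    IsBoundedAdapted 𝓖 (fun k => (S k).indicator (ξ k)) P where
  stronglyMeasurable k := (hξ.stronglyMeasurable k).indicator (hS k)
  memLp k := (hξ.memLp k).indicator (𝓖.le k _ (hS k))

variable [NormedSpace ℝ X]

lemma lt_maxTransform_iff {n : ℕ} {ω : Ω} {c : ℝ≥0} :
    c < maxTransform η ξ n ω ↔ ∃ i ≤ n, c < ‖transform η ξ i ω‖₊ := by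
  simp [maxTransform, Finset.lt_sup_iff]

lemma stronglyMeasurable_transform (hη : IsNoise 𝓖 η P) (hξ : IsBoundedAdapted 𝓖 ξ P) (n : ℕ) :
    StronglyMeasurable[𝓖 n] (transform η ξ n) := by
  unfold transform
  refine Finset.stronglyMeasurable_fun_sum _ fun k hk => ?_
  have hk := Finset.mem_range.1 hk
  exact (((hη.measurable k).mono (𝓖.mono hk) le_rfl).stronglyMeasurable).smul
    ((hξ.stronglyMeasurable k).mono (𝓖.mono hk.le))

lemma measurable_maxTransform (hη : IsNoise 𝓖 η P) (hξ : IsBoundedAdapted 𝓖 ξ P) (n : ℕ) :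
    Measurable[𝓖 n] (maxTransform η ξ n) := by
  refine measurable_of_Ioi fun c => ?_
  have : maxTransform η ξ n ⁻¹' Set.Ioi c =
      ⋃ i ∈ Set.Iic n, {ω | c < ‖transform η ξ i ω‖₊} := by
    ext ω; simp [lt_maxTransform_iff]
  rw [this]
  refine MeasurableSet.biUnion (Set.to_countable _) fun i hi => ?_
  exact measurableSet_lt measurable_const
    ((stronglyMeasurable_transform hη hξ i).mono (𝓖.mono hi)).nnnorm.measurable

lemma IsNoise.lintegral_mul (hη : IsNoise 𝓖 η P) (k : ℕ) {f : ℝ → ℝ≥0∞} (hf : Measurable f)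
    {g : Ω → ℝ≥0∞} (hg : Measurable[𝓖 k] g) :
    ∫⁻ ω, f (η k ω) * g ω ∂P = (∫⁻ ω, f (η k ω) ∂P) * ∫⁻ ω, g ω ∂P :=
  lintegral_mul_eq_lintegral_mul_lintegral_of_independent_measurableSpace
    (((hη.measurable k).mono (𝓖.le _) le_rfl).comap_le) (𝓖.le k) (hη.indep k)
    (hf.comp (comap_measurable _)) hg

lemma IsNoise.lintegral_smul_rpow_le (hη : IsNoise 𝓖 η P) (hξ : IsBoundedAdapted 𝓖 ξ P)
    {r : ℝ} (hr : 0 ≤ r) {b : ℝ≥0∞} {k : ℕ} (hb : ∫⁻ ω, ‖η k ω‖ₑ ^ r ∂P ≤ b) :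
    ∫⁻ ω, ‖η k ω • ξ k ω‖ₑ ^ r ∂P ≤ b * ∫⁻ ω, ‖ξ k ω‖ₑ ^ r ∂P := by
  have h := hη.lintegral_mul k (f := fun x => ‖x‖ₑ ^ r) (by fun_prop)
    (g := fun ω => ‖ξ k ω‖ₑ ^ r)
    ((hξ.stronglyMeasurable k).enorm.pow_const r)
  simp_rw [enorm_smul, ENNReal.mul_rpow_of_nonneg _ _ hr]
  rw [h]
  gcongr

lemma IsNoise.memLp_smul (hη : IsNoise 𝓖 η P) (hξ : IsBoundedAdapted 𝓖 ξ P) (k : ℕ)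
    {r : ℝ≥0∞} (hr : r ≠ ∞) : MemLp (fun ω => η k ω • ξ k ω) r P :=
  MemLp.smul (hξ.memLp k) (hη.memLp k r hr)

lemma IsNoise.isMartingaleDifference [CompleteSpace X] [IsProbabilityMeasure P]
    (hη : IsNoise 𝓖 η P) (hξ : IsBoundedAdapted 𝓖 ξ P) :
    IsMartingaleDifference P
      -- The filtration is shifted because `η k` is known only at time `k + 1`. The initial
      -- difference carries no conditional-expectation requirement.
      (⟨fun i => 𝓖 (i + 1), fun _ _ h => 𝓖.mono (by omega), fun i => 𝓖.le _⟩ : Filtration ℕ m0)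
      (fun k ω => η k ω • ξ k ω) where
  adapted k := (hη.measurable k).stronglyMeasurable.smul
    ((hξ.stronglyMeasurable k).mono (𝓖.mono (Nat.le_succ k)))
  integrable k := memLp_one_iff_integrable.1 (hη.memLp_smul hξ k ENNReal.one_ne_top)
  condExp_eq_zero k := by
    have hint : Integrable (η (k + 1) • ξ (k + 1)) P :=
      memLp_one_iff_integrable.1 (hη.memLp_smul hξ (k + 1) ENNReal.one_ne_top)
    have h1 := condExp_smul_of_aestronglyMeasurable_right (m := 𝓖 (k + 1))
      (memLp_one_iff_integrable.1 (hη.memLp (k + 1) 1 ENNReal.one_ne_top)) hint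
      (hξ.stronglyMeasurable (k + 1)).aestronglyMeasurable
    have h2 := condExp_indep_eq (f := η (k + 1))
      (((hη.measurable (k + 1)).mono (𝓖.le _) le_rfl).comap_le) (𝓖.le (k + 1))
      (comap_measurable _).stronglyMeasurable (hη.indep (k + 1))
    refine h1.trans ?_
    filter_upwards [h2] with ω hω
    simp [hω, hη.integral_eq_zero]

variable {s : ℝ} {C K : ℝ≥0} {a : ℕ → ℝ≥0∞}

/-- The strong-type inequality for transforms. -/
lemma lintegral_transform_rpow_le [CompleteSpace X] [IsProbabilityMeasure P] (hs : 1 < s) (hC : MartingaleTypeBound.{v, u} X s C)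
    (hη : IsNoise 𝓖 η P) (hξ : IsBoundedAdapted 𝓖 ξ P)
    (ha : ∀ k, ∫⁻ ω, ‖η k ω‖ₑ ^ s ∂P ≤ K * a k) (n : ℕ) :
    ∫⁻ ω, ‖transform η ξ n ω‖ₑ ^ s ∂P ≤
      (C ^ s * K : ℝ≥0) * ∑ k ∈ Finset.range n, a k * ∫⁻ ω, ‖ξ k ω‖ₑ ^ s ∂P := by
  have hs0 : 0 < s := by linarith
  have h := hC Ω P _ _ n (hη.isMartingaleDifference hξ)
    (fun k => hη.memLp_smul hξ k ENNReal.ofReal_ne_top)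
  have h' := ENNReal.rpow_le_rpow h hs0.le
  rw [ENNReal.mul_rpow_of_nonneg _ _ hs0.le, ← ENNReal.rpow_mul, ← ENNReal.rpow_mul,
    one_div_mul_cancel hs0.ne', ENNReal.rpow_one, ENNReal.rpow_one] at h'
  refine h'.trans ?_
  rw [ENNReal.coe_mul, mul_assoc, ENNReal.coe_rpow_of_nonneg _ hs0.le]
  gcongr
  rw [Finset.mul_sum]
  refine Finset.sum_le_sum fun k _ => ?_
  rw [← mul_assoc]
  exact hη.lintegral_smul_rpow_le hξ hs0.le (ha k)

/-- The weak-type inequality for the maximal function of a transform. -/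
lemma meas_lt_maxTransform_le [CompleteSpace X] [IsProbabilityMeasure P] (hs : 1 < s) (hC : MartingaleTypeBound.{v, u} X s C)
    (hη : IsNoise 𝓖 η P) (hξ : IsBoundedAdapted 𝓖 ξ P)
    (ha : ∀ k, ∫⁻ ω, ‖η k ω‖ₑ ^ s ∂P ≤ K * a k) (n : ℕ) (c : ℝ≥0) :
    (c : ℝ≥0∞) ^ s * P {ω | c < maxTransform η ξ n ω} ≤
      (C ^ s * K : ℝ≥0) * ∑ k ∈ Finset.range n, a k * ∫⁻ ω, ‖ξ k ω‖ₑ ^ s ∂P := by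
  have hs0 : 0 < s := by linarith
  -- Keeping the terms with `S k` stops the transform at its first passage above `c`, so on `{c <
  -- M}` the stopped transform still exceeds `c` at time `n`.
  let S : ℕ → Set Ω := fun k => {ω | maxTransform η ξ k ω ≤ c}
  have hS : ∀ k, MeasurableSet[𝓖 k] (S k) := fun k =>
    measurableSet_le (measurable_maxTransform hη hξ k) measurable_const
  have hξ' := hξ.indicator hS
  have h1 := lintegral_transform_rpow_le hs hC hη hξ' ha n
  have hsub : ∀ ω, c < maxTransform η ξ n ω →
      c < ‖transform η (fun k => (S k).indicator (ξ k)) n ω‖₊ := by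
    intro ω hω
    obtain ⟨i, hin, hi⟩ := lt_maxTransform_iff.1 hω
    classical
    let H : ∃ i, c < ‖transform η ξ i ω‖₊ := ⟨i, hi⟩
    have hmin : Nat.find H ≤ n := (Nat.find_min' H hi).trans hin
    have hmem : ∀ k, ω ∈ S k ↔ k < Nat.find H := by
      intro k
      simp only [S, Set.mem_ofPred_eq]
      rw [← not_lt, lt_maxTransform_iff, Nat.lt_find_iff]
      push Not; rfl
    have : transform η (fun k => (S k).indicator (ξ k)) n ω = transform η ξ (Nat.find H) ω := by
      unfold transform
      rw [← Finset.sum_subset (Finset.range_mono hmin)]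
      · refine Finset.sum_congr rfl fun k hk => ?_
        simp only [Set.indicator_of_mem ((hmem k).2 (Finset.mem_range.1 hk))]
      · intro k _ hk
        simp only [Set.indicator_of_notMem (fun h => hk (Finset.mem_range.2 ((hmem k).1 h))), smul_zero]
    rw [this]
    exact Nat.find_spec H
  calc (c : ℝ≥0∞) ^ s * P {ω | c < maxTransform η ξ n ω}
      ≤ (c : ℝ≥0∞) ^ s *
          P {ω | (c : ℝ≥0∞) ^ s ≤ ‖transform η (fun k => (S k).indicator (ξ k)) n ω‖ₑ ^ s} := by
        gcongr with ω
        intro hω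
        exact ENNReal.rpow_le_rpow (ENNReal.coe_le_coe.2 (hsub ω hω).le) hs0.le
    _ ≤ ∫⁻ ω, ‖transform η (fun k => (S k).indicator (ξ k)) n ω‖ₑ ^ s ∂P :=
        mul_meas_ge_le_lintegral (((stronglyMeasurable_transform hη hξ' n).mono
          (𝓖.le n)).enorm.pow_const s) _
    _ ≤ _ := h1.trans (by
        gcongr with k _ ω
        rw [enorm_indicator_eq_indicator_enorm]
        exact Set.indicator_le_self _ _ _)

lemma maxTransform_le_sum (n : ℕ) (ω : Ω) :
    (maxTransform η ξ n ω : ℝ≥0∞) ≤ ∑ k ∈ Finset.range n, ‖η k ω • ξ k ω‖ₑ := by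
  have : maxTransform η ξ n ω ≤ ∑ k ∈ Finset.range n, ‖η k ω • ξ k ω‖₊ := by
    refine Finset.sup_le fun i hi => ?_
    refine (nnnorm_sum_le _ _).trans ?_
    exact Finset.sum_le_sum_of_subset (Finset.range_mono (by simpa [Nat.lt_succ_iff] using hi))
  simpa [enorm_eq_nnnorm] using ENNReal.coe_le_coe.2 this

/-- The weak-type inequality with exponent one. -/
lemma meas_lt_maxTransform_le_one (hη : IsNoise 𝓖 η P) (hξ : IsBoundedAdapted 𝓖 ξ P)
    (ha : ∀ k, ∫⁻ ω, ‖η k ω‖ₑ ∂P ≤ K * a k) (n : ℕ) (c : ℝ≥0) :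
    (c : ℝ≥0∞) * P {ω | c < maxTransform η ξ n ω} ≤
      K * ∑ k ∈ Finset.range n, a k * ∫⁻ ω, ‖ξ k ω‖ₑ ∂P := by
  calc (c : ℝ≥0∞) * P {ω | c < maxTransform η ξ n ω}
      ≤ (c : ℝ≥0∞) * P {ω | (c : ℝ≥0∞) ≤ maxTransform η ξ n ω} := by
        gcongr with ω
        intro hω
        exact ENNReal.coe_le_coe.2 (le_of_lt hω)
    _ ≤ ∫⁻ ω, maxTransform η ξ n ω ∂P :=
        mul_meas_ge_le_lintegral (((measurable_maxTransform hη hξ n).mono (𝓖.le n)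
          le_rfl).coe_nnreal_ennreal) _
    _ ≤ ∫⁻ ω, ∑ k ∈ Finset.range n, ‖η k ω • ξ k ω‖ₑ ∂P :=
        lintegral_mono fun ω => maxTransform_le_sum n ω
    _ = ∑ k ∈ Finset.range n, ∫⁻ ω, ‖η k ω • ξ k ω‖ₑ ∂P :=
        lintegral_finsetSum' _ fun k _ =>
          (hη.memLp_smul hξ k ENNReal.one_ne_top).aestronglyMeasurable.enorm
    _ ≤ _ := by
        rw [Finset.mul_sum]
        refine Finset.sum_le_sum fun k _ => ?_
        rw [← mul_assoc]
        simpa using hη.lintegral_smul_rpow_le hξ zero_le_one (by simpa using ha k)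

end PoissonIntegral

namespace PoissonIntegral

/-! ### The good-`λ` inequality -/

lemma lintegral_coe_rpow_eq_meas_lt {Ω : Type*} {m0 : MeasurableSpace Ω} (P : Measure Ω)
    {f : Ω → ℝ≥0} (hf : Measurable f) {p : ℝ} (hp : 0 < p) :
    ∫⁻ ω, (f ω : ℝ≥0∞) ^ p ∂P = ENNReal.ofReal p *
      ∫⁻ t in Set.Ioi (0 : ℝ), P {ω | t.toNNReal < f ω} * ENNReal.ofReal (t ^ (p - 1)) := by
  have h := lintegral_rpow_eq_lintegral_meas_lt_mul P (f := fun ω => (f ω : ℝ))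
    (Filter.Eventually.of_forall fun ω => (f ω).2) hf.coe_nnreal_real.aemeasurable hp
  have h1 : ∀ ω, ENNReal.ofReal ((f ω : ℝ) ^ p) = (f ω : ℝ≥0∞) ^ p := fun ω => by
    rw [← ENNReal.ofReal_rpow_of_nonneg (NNReal.coe_nonneg _) hp.le, ENNReal.ofReal_coe_nnreal]
  simp_rw [h1] at h
  rw [h]
  congr 1
  refine setLIntegral_congr_fun measurableSet_Ioi fun t ht => ?_
  have ht : (0 : ℝ) < t := ht
  congr 2
  ext ω
  exact (Real.toNNReal_lt_iff_lt_coe ht.le).symm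

/-- The partial sums increase, so the surviving indices form an initial segment and their sum is the
last partial sum not exceeding `c`. As the test includes the current term, there is no overshoot. -/
lemma sum_range_ite_sum_le {b : ℕ → ℝ≥0∞} {c : ℝ≥0∞} (n : ℕ) :
    ∑ k ∈ Finset.range n, (if ∑ i ∈ Finset.range (k + 1), b i ≤ c then b k else 0) ≤ c := by
  induction n with
  | zero => simp
  | succ n ih =>
    by_cases h : ∑ i ∈ Finset.range (n + 1), b i ≤ c
    · refine le_trans (Finset.sum_le_sum fun k _ => ?_) h
      split_ifs <;> simp
    · rw [Finset.sum_range_succ, if_neg h, add_zero]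
      exact ih

variable {Ω : Type v} {X : Type u} [NormedAddCommGroup X] {m0 : MeasurableSpace Ω}
  {P : Measure Ω} {𝓖 : Filtration ℕ m0} {η : ℕ → Ω → ℝ} {ξ : ℕ → Ω → X}
  {s : ℝ} {C K K₁ : ℝ≥0} {a : ℕ → ℝ≥0}

lemma measurable_sum_weight (hξ : IsBoundedAdapted 𝓖 ξ P) {Ψ : ℝ≥0∞ → ℝ≥0∞}
    (hΨ : Measurable Ψ) {n j : ℕ} (hnj : n ≤ j + 1) :
    Measurable[𝓖 j] fun ω => ∑ k ∈ Finset.range n, (a k : ℝ≥0∞) * Ψ ‖ξ k ω‖ₑ := by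
  refine Finset.measurable_fun_sum _ fun k hk => ?_
  have := Finset.mem_range.1 hk
  exact (hΨ.comp (((hξ.stronglyMeasurable k).mono (𝓖.mono (by omega))).enorm)).const_mul _

variable [NormedSpace ℝ X]

/-- The good-`λ` inequality. -/
lemma meas_three_mul_lt_maxTransform_le [CompleteSpace X] [IsProbabilityMeasure P]
    (hs : 1 < s) (hC : MartingaleTypeBound.{v, u} X s C)
    (hη : IsNoise 𝓖 η P) (hξ : IsBoundedAdapted 𝓖 ξ P)
    (ha : ∀ k, ∫⁻ ω, ‖η k ω‖ₑ ^ s ∂P ≤ K * a k) (n : ℕ) {c : ℝ≥0} (hc : 0 < c) (δ : ℝ≥0) :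
    P {ω | 3 * c < maxTransform η ξ n ω} ≤
      (C ^ s * K * δ ^ s : ℝ≥0) * P {ω | c < maxTransform η ξ n ω} +
      P {ω | c < (Finset.range n).sup fun k => ‖η k ω • ξ k ω‖₊} +
      P {ω | δ * c < (∑ k ∈ Finset.range n, a k * ‖ξ k ω‖₊ ^ s) ^ (1 / s)} := by
  have hs0 : 0 < s := by linarith
  set b : ℕ → Ω → ℝ≥0∞ := fun k ω => (a k : ℝ≥0∞) * ‖ξ k ω‖ₑ ^ s with hb
  -- The transform is started once it has passed `c` and stopped before the accumulated weight
  -- exceeds `(δ c)^s`. Both conditions are known at time `k`.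
  let S : ℕ → Set Ω := fun k => {ω | c < maxTransform η ξ k ω} ∩
    {ω | ∑ i ∈ Finset.range (k + 1), b i ω ≤ (δ * c : ℝ≥0) ^ s}
  have hS : ∀ k, MeasurableSet[𝓖 k] (S k) := fun k =>
    (measurableSet_lt measurable_const (measurable_maxTransform hη hξ k)).inter
      (measurableSet_le (measurable_sum_weight hξ (Ψ := fun x => x ^ s) (by fun_prop) le_rfl)
        measurable_const)
  have hξ' := hξ.indicator hS
  set M' := maxTransform η (fun k => (S k).indicator (ξ k)) n with hM'
  have hweak := meas_lt_maxTransform_le hs hC hη hξ' ha n c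
  -- Off `{c < M}` the truncated sequence vanishes; on it the stopped weight is at most `(δ c)^s`.
  -- This produces the factor `P(c < M)` on the right.
  have hsum : ∑ k ∈ Finset.range n, (a k : ℝ≥0∞) * ∫⁻ ω, ‖(S k).indicator (ξ k) ω‖ₑ ^ s ∂P ≤
      (δ * c : ℝ≥0) ^ s * P {ω | c < maxTransform η ξ n ω} := by
    have hmeas : MeasurableSet {ω | c < maxTransform η ξ n ω} :=
      measurableSet_lt measurable_const ((measurable_maxTransform hη hξ n).mono (𝓖.le n) le_rfl)
    have hm : ∀ k, Measurable fun ω => ‖(S k).indicator (ξ k) ω‖ₑ ^ s := fun k =>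
      ((hξ'.stronglyMeasurable k).mono (𝓖.le k)).enorm.pow_const s
    simp_rw [← lintegral_const_mul _ (hm _)]
    rw [← lintegral_finsetSum _ fun k _ => (hm k).const_mul _, ← lintegral_indicator_const hmeas]
    refine lintegral_mono fun ω => ?_
    by_cases hω : c < maxTransform η ξ n ω
    · rw [Set.indicator_of_mem (by exact hω)]
      refine le_trans (Finset.sum_le_sum fun k _ => ?_)
        (sum_range_ite_sum_le (b := fun k => b k ω) (c := (δ * c : ℝ≥0) ^ s) n)
      by_cases hk : ω ∈ S k
      · have hk2 : ∑ i ∈ Finset.range (k + 1), b i ω ≤ (δ * c : ℝ≥0) ^ s := hk.2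
        rw [Set.indicator_of_mem hk, if_pos hk2]
      · rw [Set.indicator_of_notMem hk]
        simp [hs0]
    · rw [Set.indicator_of_notMem (by exact hω), nonpos_iff_eq_zero]
      refine Finset.sum_eq_zero fun k hk => ?_
      have hk : ω ∉ S k := fun h => hω <| by
        obtain ⟨i, hi, h'⟩ := lt_maxTransform_iff.1 h.1
        exact lt_maxTransform_iff.2 ⟨i, hi.trans (Finset.mem_range.1 hk).le, h'⟩
      rw [Set.indicator_of_notMem hk]
      simp [hs0]
  have hP : P {ω | c < M' ω} ≤
      (C ^ s * K * δ ^ s : ℝ≥0) * P {ω | c < maxTransform η ξ n ω} := by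
    have h := hweak.trans (mul_le_mul_right hsum _)
    have hc0 : (c : ℝ≥0∞) ^ s ≠ 0 := by simp [hc.ne', hs0]
    have hct : (c : ℝ≥0∞) ^ s ≠ ∞ := by simp [hs0.le]
    refine (ENNReal.mul_le_mul_iff_right hc0 hct).1 (h.trans (le_of_eq ?_))
    rw [ENNReal.coe_mul δ c, ENNReal.mul_rpow_of_nonneg _ _ hs0.le, ENNReal.coe_mul (C ^ s * K),
      ENNReal.coe_rpow_of_nonneg _ hs0.le]
    ring
  refine le_trans (measure_mono ?_) ((measure_union_le _ _).trans
    (add_le_add_left ((measure_union_le _ _).trans (add_le_add_left hP _)) _))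
  intro ω hω
  by_contra hcon
  simp only [Set.mem_union, Set.mem_ofPred_eq, not_or, not_lt] at hcon hω
  obtain ⟨⟨h1, h2⟩, h3⟩ := hcon
  have hA : ∑ i ∈ Finset.range n, b i ω ≤ (δ * c : ℝ≥0) ^ s := by
    have := NNReal.rpow_le_rpow h3 hs0.le
    rw [← NNReal.rpow_mul, one_div_mul_cancel hs0.ne', NNReal.rpow_one] at this
    have := ENNReal.coe_le_coe.2 this
    rw [ENNReal.coe_rpow_of_nonneg _ hs0.le] at this
    refine le_trans (le_of_eq ?_) this
    rw [ENNReal.ofNNReal_finsetSum]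
    refine Finset.sum_congr rfl fun k _ => ?_
    simp [hb, enorm_eq_nnnorm, ENNReal.coe_rpow_of_nonneg _ hs0.le]
  classical
  obtain ⟨i₁, hi₁, hlt⟩ := lt_maxTransform_iff.1 hω
  have hc3 : c ≤ 3 * c := by nlinarith [hc]
  let H : ∃ i, c < ‖transform η ξ i ω‖₊ := ⟨i₁, hc3.trans_lt hlt⟩
  have h01 : Nat.find H ≤ i₁ := Nat.find_min' H (hc3.trans_lt hlt)
  have hpos : Nat.find H ≠ 0 := fun h0 => by
    have := Nat.find_spec H
    rw [h0] at this
    simp [transform] at this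
  obtain ⟨j, hj⟩ := Nat.exists_eq_succ_of_ne_zero hpos
  -- With `j + 1` the first passage time and the total weight small, the restarted transform
  -- consists exactly of the terms after `j`.
  have hmem : ∀ k < n, (ω ∈ S k ↔ j < k) := by
    intro k hk
    have h4 : ∑ i ∈ Finset.range (k + 1), b i ω ≤ (δ * c : ℝ≥0) ^ s :=
      (Finset.sum_le_sum_of_subset (Finset.range_mono hk)).trans hA
    have h5 : c < maxTransform η ξ k ω ↔ Nat.find H ≤ k := by
      rw [lt_maxTransform_iff, Nat.find_le_iff]
    simp only [S, Set.mem_inter_iff, Set.mem_ofPred_eq, h5, hj]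
    exact ⟨fun h => h.1, fun h => ⟨h, h4⟩⟩
  have hsplit : transform η (fun k => (S k).indicator (ξ k)) i₁ ω =
      transform η ξ i₁ ω - transform η ξ (j + 1) ω := by
    rw [eq_sub_iff_add_eq', transform, transform, transform,
      ← Finset.sum_range_add_sum_Ico _ (by omega : j + 1 ≤ i₁),
      ← Finset.sum_range_add_sum_Ico (fun k => η k ω • ξ k ω) (by omega : j + 1 ≤ i₁)]
    congr 1
    rw [Finset.sum_eq_zero, zero_add]
    · refine Finset.sum_congr rfl fun k hk => ?_
      have hk := Finset.mem_Ico.1 hk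
      simp only [Set.indicator_of_mem ((hmem k (by omega)).2 (by omega))]
    · intro k hk
      have hk := Finset.mem_range.1 hk
      simp only [Set.indicator_of_notMem (mt (hmem k (by omega)).1 (by omega)), smul_zero]
  -- At most `c` before the passage plus a jump of at most `c`. Since the transform later exceeds `3
  -- c`, its restarted part must exceed `c`.
  have hjc : ‖transform η ξ (j + 1) ω‖ ≤ c + c := by
    have e : transform η ξ (j + 1) ω = transform η ξ j ω + η j ω • ξ j ω := by
      simp [transform, Finset.sum_range_succ]
    rw [e]
    refine (norm_add_le _ _).trans (add_le_add ?_ ?_)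
    · exact_mod_cast not_lt.1 (Nat.find_min H (by omega : j < Nat.find H))
    · have : ‖η j ω • ξ j ω‖₊ ≤ c :=
        (Finset.le_sup (f := fun k => ‖η k ω • ξ k ω‖₊)
          (Finset.mem_range.2 (by omega : j < n))).trans h2
      exact_mod_cast this
  have hlt' : 3 * (c : ℝ) < ‖transform η ξ i₁ ω‖ := by exact_mod_cast hlt
  refine absurd h1 (not_le.2 (lt_maxTransform_iff.2 ⟨i₁, hi₁, ?_⟩))
  rw [hsplit, ← NNReal.coe_lt_coe, coe_nnnorm]
  have := norm_sub_norm_le (transform η ξ i₁ ω) (transform η ξ (j + 1) ω)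
  linarith

end PoissonIntegral

namespace PoissonIntegral

/-! ### Rosenthal-type inequality -/

/-- The factor `r` lets the levels `3 c`, `c` and `δ c` of the good-`λ` inequality be integrated in
the same variable. -/
lemma lintegral_coe_rpow_eq_meas_mul_lt {Ω : Type*} {m0 : MeasurableSpace Ω} (P : Measure Ω)
    {f : Ω → ℝ≥0} (hf : Measurable f) {p : ℝ} (hp : 0 < p) {r : ℝ≥0} (hr : 0 < r) :
    ∫⁻ ω, (f ω : ℝ≥0∞) ^ p ∂P = (r ^ p : ℝ≥0) * (ENNReal.ofReal p *
      ∫⁻ t in Set.Ioi (0 : ℝ), P {ω | r * t.toNNReal < f ω} * ENNReal.ofReal (t ^ (p - 1))) := by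
  have h := lintegral_coe_rpow_eq_meas_lt P (f := fun ω => r⁻¹ * f ω) (hf.const_mul _) hp
  have h1 : ∀ (t : ℝ) ω, t.toNNReal < r⁻¹ * f ω ↔ r * t.toNNReal < f ω := fun t ω => by
    rw [inv_mul_eq_div, lt_div_iff₀ hr, mul_comm]
  simp_rw [h1] at h
  rw [← h, ← lintegral_const_mul _ ((hf.const_mul _).coe_nnreal_ennreal.pow_const p)]
  refine lintegral_congr fun ω => ?_
  rw [← ENNReal.coe_rpow_of_nonneg _ hp.le, ← ENNReal.coe_rpow_of_nonneg _ hp.le,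
    ← ENNReal.coe_mul, ← NNReal.mul_rpow, mul_inv_cancel_left₀ hr.ne']

lemma measurable_meas_mul_lt {Ω : Type*} {m0 : MeasurableSpace Ω} (P : Measure Ω)
    (f : Ω → ℝ≥0) (r : ℝ≥0) (p : ℝ) :
    Measurable fun t : ℝ => P {ω | r * t.toNNReal < f ω} * ENNReal.ofReal (t ^ (p - 1)) := by
  refine Measurable.mul (Antitone.measurable fun t u htu => measure_mono fun ω hω => ?_)
    (by fun_prop)
  exact lt_of_le_of_lt (mul_le_mul_right (Real.toNNReal_le_toNNReal htu) r) hω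

variable {Ω : Type v} {X : Type u} [NormedAddCommGroup X] [NormedSpace ℝ X]
  {m0 : MeasurableSpace Ω}
  {P : Measure Ω} {𝓖 : Filtration ℕ m0} {η : ℕ → Ω → ℝ} {ξ : ℕ → Ω → X}
  {s p : ℝ} {C K K₁ : ℝ≥0} {a : ℕ → ℝ≥0}

/-- A crude bound, without cancellation; its role is to make the absorption step legitimate. -/
lemma lintegral_maxTransform_rpow_lt_top (hη : IsNoise 𝓖 η P) (hξ : IsBoundedAdapted 𝓖 ξ P)
    (hp : 0 < p) (n : ℕ) : ∫⁻ ω, (maxTransform η ξ n ω : ℝ≥0∞) ^ p ∂P < ∞ := by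
  have h : MemLp (fun ω => ∑ k ∈ Finset.range n, ‖η k ω • ξ k ω‖) (ENNReal.ofReal p) P :=
    memLp_finsetSum _ fun k _ => (hη.memLp_smul hξ k ENNReal.ofReal_ne_top).norm
  have h2 := lintegral_rpow_enorm_lt_top_of_eLpNorm_lt_top (by simpa using hp)
    ENNReal.ofReal_ne_top h.2
  refine lt_of_le_of_lt (lintegral_mono fun ω => ?_) h2
  rw [ENNReal.toReal_ofReal hp.le]
  refine ENNReal.rpow_le_rpow ((maxTransform_le_sum n ω).trans (le_of_eq ?_)) hp.le
  rw [Real.enorm_eq_ofReal (by positivity), ENNReal.ofReal_sum_of_nonneg fun _ _ => norm_nonneg _]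
  simp_rw [ofReal_norm]

/-- A Rosenthal-type inequality for transforms of independent noise. -/
theorem lintegral_maxTransform_rpow_le [CompleteSpace X] [IsProbabilityMeasure P]
    (hs : 1 < s) (hp : 0 < p) (hC : MartingaleTypeBound.{v, u} X s C)
    (hη : IsNoise 𝓖 η P) (hξ : IsBoundedAdapted 𝓖 ξ P)
    (ha : ∀ k, ∫⁻ ω, ‖η k ω‖ₑ ^ s ∂P ≤ K * a k) (ha₁ : ∀ k, ∫⁻ ω, ‖η k ω‖ₑ ^ p ∂P ≤ K₁ * a k)
    (n : ℕ) {δ : ℝ≥0} (hδ0 : 0 < δ) (hδ : 2 * 3 ^ p * (C ^ s * K * δ ^ s) ≤ 1) :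
    ∫⁻ ω, (maxTransform η ξ n ω : ℝ≥0∞) ^ p ∂P ≤
      (2 * 3 ^ p : ℝ≥0) * (K₁ * ∫⁻ ω, ∑ k ∈ Finset.range n, a k * ‖ξ k ω‖ₑ ^ p ∂P +
        (δ⁻¹ ^ p : ℝ≥0) * ∫⁻ ω, (∑ k ∈ Finset.range n, a k * ‖ξ k ω‖ₑ ^ s) ^ (p / s) ∂P) := by
  have hs0 : 0 < s := by linarith
  set f : Ω → ℝ≥0 := maxTransform η ξ n
  set D : Ω → ℝ≥0 := fun ω => (Finset.range n).sup fun k => ‖η k ω • ξ k ω‖₊ with hD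
  set A : Ω → ℝ≥0 := fun ω => (∑ k ∈ Finset.range n, a k * ‖ξ k ω‖₊ ^ s) ^ (1 / s) with hA
  have hξm : ∀ k, StronglyMeasurable (ξ k) := fun k => (hξ.stronglyMeasurable k).mono (𝓖.le k)
  have hηm : ∀ k, Measurable (η k) := fun k => (hη.measurable k).mono (𝓖.le _) le_rfl
  have hdm : ∀ k, StronglyMeasurable fun ω => η k ω • ξ k ω := fun k =>
    (hηm k).stronglyMeasurable.smul (hξm k)
  have hfm : Measurable f := (measurable_maxTransform hη hξ n).mono (𝓖.le n) le_rfl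
  have hDm : Measurable D := by
    refine measurable_of_Ioi fun c => ?_
    have : D ⁻¹' Set.Ioi c = ⋃ k ∈ Set.Iio n, {ω | c < ‖η k ω • ξ k ω‖₊} := by
      ext ω; simp [hD, Finset.lt_sup_iff]
    rw [this]
    exact MeasurableSet.biUnion (Set.to_countable _) fun k _ =>
      measurableSet_lt measurable_const (hdm k).nnnorm.measurable
  have hAm : Measurable A := (Finset.measurable_fun_sum _ fun k _ =>
    ((hξm k).nnnorm.measurable.pow_const s).const_mul _).pow_const _
  -- The largest jump is bounded by the `ℓ^p` sum of all jumps, and independence separates `η k`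
  -- from `ξ k`.
  have hDp : ∫⁻ ω, (D ω : ℝ≥0∞) ^ p ∂P ≤
      K₁ * ∫⁻ ω, ∑ k ∈ Finset.range n, a k * ‖ξ k ω‖ₑ ^ p ∂P := by
    calc ∫⁻ ω, (D ω : ℝ≥0∞) ^ p ∂P
        ≤ ∫⁻ ω, ∑ k ∈ Finset.range n, ‖η k ω • ξ k ω‖ₑ ^ p ∂P := by
          refine lintegral_mono fun ω => ?_
          rcases Finset.eq_empty_or_nonempty (Finset.range n) with h | h
          · simp [hD, h, hp]
          · obtain ⟨k, hk, hke⟩ := Finset.exists_mem_eq_sup _ h fun k => ‖η k ω • ξ k ω‖₊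
            simp only [hD, hke]
            exact Finset.single_le_sum (f := fun k => ‖η k ω • ξ k ω‖ₑ ^ p)
              (fun _ _ => zero_le) hk
      _ = ∑ k ∈ Finset.range n, ∫⁻ ω, ‖η k ω • ξ k ω‖ₑ ^ p ∂P :=
          lintegral_finsetSum _ fun k _ => (hdm k).enorm.pow_const p
      _ ≤ ∑ k ∈ Finset.range n, K₁ * a k * ∫⁻ ω, ‖ξ k ω‖ₑ ^ p ∂P :=
          Finset.sum_le_sum fun k _ => hη.lintegral_smul_rpow_le hξ hp.le (ha₁ k)
      _ = _ := by
          rw [lintegral_finsetSum _ fun k _ => ((hξm k).enorm.pow_const p).const_mul _,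
            Finset.mul_sum]
          refine Finset.sum_congr rfl fun k _ => ?_
          rw [lintegral_const_mul _ ((hξm k).enorm.pow_const p), mul_assoc]
  have hAp : ∫⁻ ω, (A ω : ℝ≥0∞) ^ p ∂P =
      ∫⁻ ω, (∑ k ∈ Finset.range n, a k * ‖ξ k ω‖ₑ ^ s) ^ (p / s) ∂P := by
    refine lintegral_congr fun ω => ?_
    rw [hA, ← ENNReal.coe_rpow_of_nonneg _ hp.le, ← NNReal.rpow_mul, one_div_mul_eq_div,
      ENNReal.coe_rpow_of_nonneg _ (by positivity), ENNReal.ofNNReal_finsetSum]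
    simp [enorm_eq_nnnorm, ENNReal.coe_rpow_of_nonneg _ hs0.le]
  set w : (Ω → ℝ≥0) → ℝ≥0 → ℝ → ℝ≥0∞ := fun g r t =>
    P {ω | r * t.toNNReal < g ω} * ENNReal.ofReal (t ^ (p - 1)) with hw
  have hwm : ∀ g r, Measurable (w g r) := fun g r => measurable_meas_mul_lt P g r p
  have h1 := lintegral_coe_rpow_eq_meas_mul_lt P hfm hp (r := 1) one_pos
  have h2 := lintegral_coe_rpow_eq_meas_mul_lt P hDm hp (r := 1) one_pos
  have h3 := lintegral_coe_rpow_eq_meas_mul_lt P hAm hp hδ0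
  have h4 := lintegral_coe_rpow_eq_meas_mul_lt P hfm hp (r := 3) (by norm_num)
  have hgood : ∫⁻ t in Set.Ioi (0 : ℝ), w f 3 t ≤
      (C ^ s * K * δ ^ s : ℝ≥0) * (∫⁻ t in Set.Ioi (0 : ℝ), w f 1 t) +
      (∫⁻ t in Set.Ioi (0 : ℝ), w D 1 t) + ∫⁻ t in Set.Ioi (0 : ℝ), w A δ t := by
    rw [← lintegral_const_mul _ (hwm f 1), ← lintegral_add_left ((hwm f 1).const_mul _),
      ← lintegral_add_right _ (hwm A δ)]
    refine setLIntegral_mono' measurableSet_Ioi fun t ht => ?_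
    simp only [hw, ← mul_assoc, ← add_mul, one_mul]
    gcongr
    exact meas_three_mul_lt_maxTransform_le hs hC hη hξ ha n (Real.toNNReal_pos.2 ht) δ
  simp only [NNReal.one_rpow, ENNReal.coe_one, one_mul] at h1 h2
  have hfin := (lintegral_maxTransform_rpow_lt_top hη hξ hp n).ne
  set x := ∫⁻ ω, (f ω : ℝ≥0∞) ^ p ∂P
  have hδp : (δ⁻¹ ^ p : ℝ≥0) * ∫⁻ ω, (A ω : ℝ≥0∞) ^ p ∂P =
      ENNReal.ofReal p * ∫⁻ t in Set.Ioi (0 : ℝ), w A δ t := by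
    rw [h3, ← mul_assoc, ← ENNReal.coe_mul, ← NNReal.mul_rpow, inv_mul_cancel₀ hδ0.ne',
      NNReal.one_rpow, ENNReal.coe_one, one_mul]
  have hx : x ≤ (3 ^ p : ℝ≥0) * ((C ^ s * K * δ ^ s : ℝ≥0) * x + ∫⁻ ω, (D ω : ℝ≥0∞) ^ p ∂P +
      (δ⁻¹ ^ p : ℝ≥0) * ∫⁻ ω, (A ω : ℝ≥0∞) ^ p ∂P) := by
    have e : (C ^ s * K * δ ^ s : ℝ≥0) * x + ∫⁻ ω, (D ω : ℝ≥0∞) ^ p ∂P +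
        (δ⁻¹ ^ p : ℝ≥0) * ∫⁻ ω, (A ω : ℝ≥0∞) ^ p ∂P = ENNReal.ofReal p *
        ((C ^ s * K * δ ^ s : ℝ≥0) * (∫⁻ t in Set.Ioi (0 : ℝ), w f 1 t) +
          (∫⁻ t in Set.Ioi (0 : ℝ), w D 1 t) + ∫⁻ t in Set.Ioi (0 : ℝ), w A δ t) := by
      rw [hδp, h1, h2]
      simp only [hw, one_mul]
      ring
    rw [e]
    calc x = _ := h4
      _ ≤ _ := by gcongr
  rw [← hAp]
  refine le_trans ?_ (mul_le_mul_right (add_le_add_left hDp _) _)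
  set y := ∫⁻ ω, (D ω : ℝ≥0∞) ^ p ∂P + (δ⁻¹ ^ p : ℝ≥0) * ∫⁻ ω, (A ω : ℝ≥0∞) ^ p ∂P
  -- After doubling, `hδ` makes the coefficient of `x` on the right at most `1`; finiteness of `x`
  -- then allows cancelling it.
  have hx2 : x + x ≤ x + (2 * 3 ^ p : ℝ≥0) * y := by
    calc x + x = 2 * x := (two_mul x).symm
      _ ≤ 2 * _ := mul_le_mul_right hx 2
      _ = (2 * 3 ^ p * (C ^ s * K * δ ^ s) : ℝ≥0) * x + (2 * 3 ^ p : ℝ≥0) * y := by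
        simp only [ENNReal.coe_mul, ENNReal.coe_ofNat, y]; ring
      _ ≤ 1 * x + _ := by
        gcongr
        exact_mod_cast hδ
      _ = _ := by rw [one_mul]
  exact (ENNReal.add_le_add_iff_left hfin).1 hx2

end PoissonIntegral

namespace PoissonIntegral

/-! ### Small exponents -/

/-- The function `min x (x ^ s)`, the modular of `L^1 + L^s`. -/
noncomputable def minPow (s : ℝ) (x : ℝ≥0∞) : ℝ≥0∞ := min x (x ^ s)

lemma measurable_minPow (s : ℝ) : Measurable (minPow s) :=
  measurable_id.min (measurable_id.pow_const s)

lemma minPow_mono {s : ℝ} (hs : 0 ≤ s) : Monotone (minPow s) := fun _ _ h =>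
  min_le_min h (ENNReal.rpow_le_rpow h hs)

variable {Ω : Type v} {X : Type u} [NormedAddCommGroup X] [NormedSpace ℝ X]
  {m0 : MeasurableSpace Ω}
  {P : Measure Ω} {𝓖 : Filtration ℕ m0} {η : ℕ → Ω → ℝ} {ξ : ℕ → Ω → X}
  {s p : ℝ} {C K K₁ : ℝ≥0} {a : ℕ → ℝ≥0}

/-- Small coefficients are handled by martingale type and large ones by the bound with exponent one;
in both regimes the cost is exactly `minPow s (‖ξ k‖ / c)`. The constant adds up the event `1 < V`
and the two weak-type bounds. -/
lemma meas_two_mul_lt_maxTransform_le [CompleteSpace X] [IsProbabilityMeasure P]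
    (hs : 1 < s) (hC : MartingaleTypeBound.{v, u} X s C)
    (hη : IsNoise 𝓖 η P) (hξ : IsBoundedAdapted 𝓖 ξ P)
    (ha : ∀ k, ∫⁻ ω, ‖η k ω‖ₑ ^ s ∂P ≤ K * a k) (ha₁ : ∀ k, ∫⁻ ω, ‖η k ω‖ₑ ∂P ≤ K₁ * a k)
    (n : ℕ) {c : ℝ≥0} (hc : 0 < c) :
    P {ω | 2 * c < maxTransform η ξ n ω} ≤ (1 + C ^ s * K + K₁ : ℝ≥0) *
      ∫⁻ ω, min 1 (∑ k ∈ Finset.range n, a k * minPow s (‖ξ k ω‖ₑ / c)) ∂P := by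
  have hs0 : 0 < s := by linarith
  have hc0 : (c : ℝ≥0∞) ≠ 0 := by simp [hc.ne']
  have hΨ : Measurable fun x : ℝ≥0∞ => minPow s (x / c) :=
    (measurable_minPow s).comp (measurable_id.div_const _)
  set b : ℕ → Ω → ℝ≥0∞ := fun k ω => (a k : ℝ≥0∞) * minPow s (‖ξ k ω‖ₑ / c) with hb
  set V : Ω → ℝ≥0∞ := fun ω => ∑ k ∈ Finset.range n, b k ω with hV
  have hVm : Measurable V := (measurable_sum_weight hξ hΨ (Nat.le_succ n)).mono (𝓖.le n) le_rfl
  let T : ℕ → Set Ω := fun k => {ω | ∑ i ∈ Finset.range (k + 1), b i ω ≤ 1}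
  have hT : ∀ k, MeasurableSet[𝓖 k] (T k) := fun k =>
    measurableSet_le (measurable_sum_weight hξ hΨ le_rfl) measurable_const
  let S₁ : ℕ → Set Ω := fun k => T k ∩ {ω | ‖ξ k ω‖ₑ ≤ c}
  let S₂ : ℕ → Set Ω := fun k => T k ∩ {ω | (c : ℝ≥0∞) < ‖ξ k ω‖ₑ}
  have hS₁ : ∀ k, MeasurableSet[𝓖 k] (S₁ k) := fun k =>
    (hT k).inter (measurableSet_le (hξ.stronglyMeasurable k).enorm measurable_const)
  have hS₂ : ∀ k, MeasurableSet[𝓖 k] (S₂ k) := fun k =>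
    (hT k).inter (measurableSet_lt measurable_const (hξ.stronglyMeasurable k).enorm)
  have hξ₁ := hξ.indicator hS₁
  have hξ₂ := hξ.indicator hS₂
  -- Stopping before the weight exceeds `1` supplies the cap in `min 1 (V ω)`.
  have hstopped : ∀ ω, ∑ k ∈ Finset.range n,
      (if ∑ i ∈ Finset.range (k + 1), b i ω ≤ 1 then b k ω else 0) ≤ min 1 (V ω) := fun ω =>
    le_min (sum_range_ite_sum_le n) (Finset.sum_le_sum fun k _ => by split_ifs <;> simp)
  have hW₁ := meas_lt_maxTransform_le hs hC hη hξ₁ ha n c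
  have hW₂ := meas_lt_maxTransform_le_one hη hξ₂ ha₁ n c
  have hI₁ : ∑ k ∈ Finset.range n, (a k : ℝ≥0∞) * ∫⁻ ω, ‖(S₁ k).indicator (ξ k) ω‖ₑ ^ s ∂P ≤
      (c : ℝ≥0∞) ^ s * ∫⁻ ω, min 1 (V ω) ∂P := by
    have hm : ∀ k, Measurable fun ω => ‖(S₁ k).indicator (ξ k) ω‖ₑ ^ s := fun k =>
      ((hξ₁.stronglyMeasurable k).mono (𝓖.le k)).enorm.pow_const s
    simp_rw [← lintegral_const_mul _ (hm _)]
    rw [← lintegral_finsetSum _ fun k _ => (hm k).const_mul _,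
      ← lintegral_const_mul _ (measurable_const.min hVm)]
    refine lintegral_mono fun ω => ?_
    refine le_trans ?_ (mul_le_mul_right (hstopped ω) _)
    rw [Finset.mul_sum]
    refine Finset.sum_le_sum fun k _ => ?_
    by_cases hk : ω ∈ S₁ k
    · have hk1 : ∑ i ∈ Finset.range (k + 1), b i ω ≤ 1 := hk.1
      have hk2 : ‖ξ k ω‖ₑ / c ≤ 1 := ENNReal.div_le_of_le_mul (by simpa using! hk.2)
      have hmin : minPow s (‖ξ k ω‖ₑ / c) = (‖ξ k ω‖ₑ / c) ^ s :=
        min_eq_right (ENNReal.rpow_le_self_of_le_one hk2 hs.le)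
      rw [Set.indicator_of_mem hk, if_pos hk1, hb]
      simp only [hmin]
      rw [mul_left_comm, ← ENNReal.mul_rpow_of_nonneg _ _ hs0.le,
        ENNReal.mul_div_cancel hc0 ENNReal.coe_ne_top]
    · rw [Set.indicator_of_notMem hk]
      simp [hs0]
  have hI₂ : ∑ k ∈ Finset.range n, (a k : ℝ≥0∞) * ∫⁻ ω, ‖(S₂ k).indicator (ξ k) ω‖ₑ ∂P ≤
      (c : ℝ≥0∞) * ∫⁻ ω, min 1 (V ω) ∂P := by
    have hm : ∀ k, Measurable fun ω => ‖(S₂ k).indicator (ξ k) ω‖ₑ := fun k =>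
      ((hξ₂.stronglyMeasurable k).mono (𝓖.le k)).enorm
    simp_rw [← lintegral_const_mul _ (hm _)]
    rw [← lintegral_finsetSum _ fun k _ => (hm k).const_mul _,
      ← lintegral_const_mul _ (measurable_const.min hVm)]
    refine lintegral_mono fun ω => ?_
    refine le_trans ?_ (mul_le_mul_right (hstopped ω) _)
    rw [Finset.mul_sum]
    refine Finset.sum_le_sum fun k _ => ?_
    by_cases hk : ω ∈ S₂ k
    · have hk1 : ∑ i ∈ Finset.range (k + 1), b i ω ≤ 1 := hk.1
      have hk2 : 1 ≤ ‖ξ k ω‖ₑ / c := by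
        rw [ENNReal.le_div_iff_mul_le (Or.inl hc0) (Or.inl ENNReal.coe_ne_top), one_mul]
        exact le_of_lt hk.2
      have hmin : minPow s (‖ξ k ω‖ₑ / c) = ‖ξ k ω‖ₑ / c :=
        min_eq_left (by simpa using ENNReal.rpow_le_rpow_of_exponent_le hk2 hs.le)
      rw [Set.indicator_of_mem hk, if_pos hk1, hb]
      simp only [hmin]
      rw [mul_left_comm, ENNReal.mul_div_cancel hc0 ENNReal.coe_ne_top]
    · rw [Set.indicator_of_notMem hk]
      simp
  have hP₁ : P {ω | c < maxTransform η (fun k => (S₁ k).indicator (ξ k)) n ω} ≤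
      (C ^ s * K : ℝ≥0) * ∫⁻ ω, min 1 (V ω) ∂P := by
    refine (ENNReal.mul_le_mul_iff_right (a := (c : ℝ≥0∞) ^ s) (by simp [hc.ne', hs0])
      (by simp [hs0.le])).1 ((hW₁.trans (mul_le_mul_right hI₁ _)).trans_eq ?_)
    ring
  have hP₂ : P {ω | c < maxTransform η (fun k => (S₂ k).indicator (ξ k)) n ω} ≤
      K₁ * ∫⁻ ω, min 1 (V ω) ∂P := by
    refine (ENNReal.mul_le_mul_iff_right (a := (c : ℝ≥0∞)) hc0
      ENNReal.coe_ne_top).1 ((hW₂.trans (mul_le_mul_right hI₂ _)).trans_eq ?_)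
    ring
  have hP₀ : P {ω | 1 < V ω} ≤ ∫⁻ ω, min 1 (V ω) ∂P := by
    refine le_trans (measure_mono fun ω hω => ?_)
      ((one_mul (P {ω | 1 ≤ min 1 (V ω)})).symm.le.trans
        (mul_meas_ge_le_lintegral (measurable_const.min hVm) 1))
    exact le_min le_rfl (le_of_lt (show 1 < V ω from hω))
  -- If `V ω ≤ 1`, nothing is stopped and the two truncated transforms add up to the full one, so
  -- one of them must exceed `c`.
  have hsub : {ω | 2 * c < maxTransform η ξ n ω} ⊆ {ω | 1 < V ω} ∪
      ({ω | c < maxTransform η (fun k => (S₁ k).indicator (ξ k)) n ω} ∪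
        {ω | c < maxTransform η (fun k => (S₂ k).indicator (ξ k)) n ω}) := by
    intro ω hω
    by_contra hcon
    simp only [Set.mem_union, Set.mem_ofPred_eq, not_or] at hcon hω
    obtain ⟨h0, h1, h2⟩ := hcon
    obtain ⟨i, hi, hlt⟩ := lt_maxTransform_iff.1 hω
    rw [lt_maxTransform_iff] at h1 h2
    push Not at h1 h2
    have hTk : ∀ k < n, ω ∈ T k := fun k hk =>
      (Finset.sum_le_sum_of_subset (Finset.range_mono hk)).trans (not_lt.1 h0)
    have hsum : transform η ξ i ω = transform η (fun k => (S₁ k).indicator (ξ k)) i ω +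
        transform η (fun k => (S₂ k).indicator (ξ k)) i ω := by
      unfold transform
      rw [← Finset.sum_add_distrib]
      refine Finset.sum_congr rfl fun k hk => ?_
      have hk := hTk k ((Finset.mem_range.1 hk).trans_le hi)
      rw [← smul_add]
      congr 1
      by_cases hle : ‖ξ k ω‖ₑ ≤ c
      · have m1 : ω ∈ S₁ k := ⟨hk, hle⟩
        have m2 : ω ∉ S₂ k := fun h => absurd h.2 (not_lt.2 hle)
        simp [Set.indicator_of_mem m1, Set.indicator_of_notMem m2]
      · have m1 : ω ∉ S₁ k := fun h => hle h.2
        have m2 : ω ∈ S₂ k := ⟨hk, not_le.1 hle⟩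
        simp [Set.indicator_of_notMem m1, Set.indicator_of_mem m2]
    refine absurd hlt (not_lt.2 ?_)
    rw [hsum, two_mul]
    exact (nnnorm_add_le _ _).trans (add_le_add (h1 i hi) (h2 i hi))
  refine (measure_mono hsub).trans ((measure_union_le _ _).trans
    ((add_le_add hP₀ ((measure_union_le _ _).trans (add_le_add hP₁ hP₂))).trans_eq ?_))
  simp only [ENNReal.coe_add, ENNReal.coe_one]
  ring

theorem lintegral_maxTransform_rpow_le_lintegral_minPow [CompleteSpace X] [IsProbabilityMeasure P]
    (hs : 1 < s) (hp : 0 < p) (hC : MartingaleTypeBound.{v, u} X s C)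
    (hη : IsNoise 𝓖 η P) (hξ : IsBoundedAdapted 𝓖 ξ P)
    (ha : ∀ k, ∫⁻ ω, ‖η k ω‖ₑ ^ s ∂P ≤ K * a k) (ha₁ : ∀ k, ∫⁻ ω, ‖η k ω‖ₑ ∂P ≤ K₁ * a k)
    (n : ℕ) :
    ∫⁻ ω, (maxTransform η ξ n ω : ℝ≥0∞) ^ p ∂P ≤
      (2 ^ p * p.toNNReal * (1 + C ^ s * K + K₁) : ℝ≥0) * ∫⁻ t in Set.Ioi (0 : ℝ),
        (∫⁻ ω, min 1 (∑ k ∈ Finset.range n, a k * minPow s (‖ξ k ω‖ₑ / ENNReal.ofReal t)) ∂P) *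
          ENNReal.ofReal (t ^ (p - 1)) := by
  rw [lintegral_coe_rpow_eq_meas_mul_lt P ((measurable_maxTransform hη hξ n).mono (𝓖.le n) le_rfl)
    hp (r := 2) two_pos, ENNReal.coe_mul, ENNReal.coe_mul, mul_assoc, mul_assoc]
  refine mul_le_mul_right (mul_le_mul_right ?_ _) _
  rw [← lintegral_const_mul' _ _ ENNReal.coe_ne_top]
  refine setLIntegral_mono' measurableSet_Ioi fun t ht => ?_
  rw [← mul_assoc]
  exact mul_le_mul_left
    (meas_two_mul_lt_maxTransform_le hs hC hη hξ ha ha₁ n (Real.toNNReal_pos.2 ht)) _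

/-! ### The modular of `L^1 + L^s` -/

/-- `x + y` is at most twice the larger term, and doubling the argument costs at most `2 ^ s`. -/
lemma minPow_add_le (hs1 : 1 ≤ s) (x y : ℝ≥0∞) :
    minPow s (x + y) ≤ 2 ^ s * (minPow s x + minPow s y) := by
  have hs : 0 ≤ s := by linarith
  have key : ∀ z, minPow s (2 * z) ≤ 2 ^ s * minPow s z := fun z => by
    unfold minPow
    rw [mul_min]
    refine min_le_min ?_ (ENNReal.mul_rpow_of_nonneg _ _ hs).le
    gcongr
    simpa using ENNReal.rpow_le_rpow_of_exponent_le (x := 2) (by norm_num) hs1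
  rcases le_total x y with h | h
  · calc minPow s (x + y) ≤ minPow s (2 * y) := minPow_mono hs (by rw [two_mul]; gcongr)
      _ ≤ 2 ^ s * minPow s y := key y
      _ ≤ _ := by gcongr; exact le_add_self
  · calc minPow s (x + y) ≤ minPow s (2 * x) := minPow_mono hs (by rw [two_mul]; gcongr)
      _ ≤ 2 ^ s * minPow s x := key x
      _ ≤ _ := by gcongr; exact le_self_add

lemma min_one_rpow_le_minPow (hs : 1 ≤ s) (x : ℝ≥0∞) : min 1 (x ^ s) ≤ minPow s x := by
  rcases le_total 1 x with h | h
  · exact le_min ((min_le_left _ _).trans h) (min_le_right _ _)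
  · exact le_min ((min_le_right _ _).trans (ENNReal.rpow_le_self_of_le_one h hs)) (min_le_right _ _)

end PoissonIntegral

namespace PoissonIntegral

/-! ### Integrating the modular over all levels -/

lemma lintegral_Ioc_rpow {x r : ℝ} (hx : 0 < x) (hr : -1 < r) :
    ∫⁻ t in Set.Ioc 0 x, ENNReal.ofReal (t ^ r) = ENNReal.ofReal (x ^ (r + 1) / (r + 1)) := by
  rw [← ofReal_integral_eq_lintegral_ofReal
    ((intervalIntegral.intervalIntegrable_rpow' hr (a := 0) (b := x)).1)]
  · rw [← intervalIntegral.integral_of_le hx.le, integral_rpow (Or.inl hr),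
      Real.zero_rpow (by linarith), sub_zero]
  · exact (ae_restrict_mem measurableSet_Ioc).mono fun t ht => Real.rpow_nonneg ht.1.le _

lemma lintegral_Ioi_rpow {x r : ℝ} (hx : 0 < x) (hr : r < -1) :
    ∫⁻ t in Set.Ioi x, ENNReal.ofReal (t ^ r) = ENNReal.ofReal (-x ^ (r + 1) / (r + 1)) := by
  rw [← ofReal_integral_eq_lintegral_ofReal (integrableOn_Ioi_rpow_of_lt hr hx),
    integral_Ioi_rpow_of_lt hr hx]
  exact (ae_restrict_mem measurableSet_Ioi).mono fun t ht => Real.rpow_nonneg (hx.trans ht).le _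

/-- Split at `t = x`. Below, the integrand is at most `x t^(p-2)`, integrable at zero because `p >
1`; above, at most `x^s t^(p-1-s)`, integrable at infinity because `p < s`. These give the two
summands of the constant. -/
lemma lintegral_minPow_mul_rpow_le {s p : ℝ} (hp : 1 < p) (hps : p < s) (x : ℝ≥0∞) :
    ∫⁻ t in Set.Ioi (0 : ℝ), minPow s (x / ENNReal.ofReal t) * ENNReal.ofReal (t ^ (p - 1)) ≤
      ENNReal.ofReal (1 / (p - 1) + 1 / (s - p)) * x ^ p := by
  have hp0 : 0 < p := by linarith
  have hs0 : 0 < s := by linarith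
  have hκ : 0 < 1 / (p - 1) + 1 / (s - p) :=
    add_pos (one_div_pos.2 (by linarith)) (one_div_pos.2 (by linarith))
  induction x with
  | top =>
    rw [ENNReal.top_rpow_of_pos hp0, ENNReal.mul_top (by simpa using hκ)]
    exact le_top
  | coe x =>
    rcases eq_or_ne x 0 with rfl | hx
    · simp [minPow, hs0]
    have hx0 : (0 : ℝ) < x := by positivity
    have e : ∀ t : ℝ, 0 < t → (x : ℝ≥0∞) / ENNReal.ofReal t = ENNReal.ofReal (x / t) :=
      fun t ht => by rw [ENNReal.ofReal_div_of_pos ht, ENNReal.ofReal_coe_nnreal]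
    have h1 : ∫⁻ t in Set.Ioc (0 : ℝ) x, minPow s (x / ENNReal.ofReal t) *
        ENNReal.ofReal (t ^ (p - 1)) ≤ ENNReal.ofReal ((x : ℝ) ^ p / (p - 1)) := by
      calc _ ≤ ∫⁻ t in Set.Ioc (0 : ℝ) x, ENNReal.ofReal x * ENNReal.ofReal (t ^ (p - 2)) := by
            refine setLIntegral_mono' measurableSet_Ioc fun t ht => ?_
            refine (mul_le_mul_left (min_le_left _ _) _).trans_eq ?_
            rw [e t ht.1, ← ENNReal.ofReal_mul (div_pos hx0 ht.1).le, ← ENNReal.ofReal_mul hx0.le]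
            congr 1
            rw [show p - 1 = p - 2 + 1 by ring, Real.rpow_add_one ht.1.ne']
            field_simp [ht.1.ne']
        _ = _ := by
            rw [lintegral_const_mul' _ _ ENNReal.ofReal_ne_top,
              lintegral_Ioc_rpow hx0 (by linarith), ← ENNReal.ofReal_mul hx0.le]
            congr 1
            rw [show p - 2 + 1 = p - 1 by ring, Real.rpow_sub_one hx0.ne']
            field_simp [hx0.ne']
    have h2 : ∫⁻ t in Set.Ioi (x : ℝ), minPow s (x / ENNReal.ofReal t) *
        ENNReal.ofReal (t ^ (p - 1)) ≤ ENNReal.ofReal ((x : ℝ) ^ p / (s - p)) := by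
      calc _ ≤ ∫⁻ t in Set.Ioi (x : ℝ), ENNReal.ofReal ((x : ℝ) ^ s) *
            ENNReal.ofReal (t ^ (p - 1 - s)) := by
            refine setLIntegral_mono' measurableSet_Ioi fun t ht => ?_
            have ht0 : 0 < t := hx0.trans ht
            refine (mul_le_mul_left (min_le_right _ _) _).trans_eq ?_
            rw [e t ht0, ENNReal.ofReal_rpow_of_pos (div_pos hx0 ht0),
              ← ENNReal.ofReal_mul (by positivity), ← ENNReal.ofReal_mul (by positivity)]
            congr 1
            rw [Real.div_rpow hx0.le ht0.le, Real.rpow_sub ht0 (p - 1)]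
            ring
        _ = _ := by
            rw [lintegral_const_mul' _ _ ENNReal.ofReal_ne_top,
              lintegral_Ioi_rpow hx0 (by linarith), ← ENNReal.ofReal_mul (by positivity)]
            congr 1
            rw [show p - 1 - s + 1 = p - s by ring, Real.rpow_sub hx0]
            have : (x : ℝ) ^ s ≠ 0 := (Real.rpow_pos_of_pos hx0 s).ne'
            have h3 : s - p ≠ 0 := by linarith
            rw [← neg_sub s p]
            field_simp
    rw [← Set.Ioc_union_Ioi_eq_Ioi hx0.le]
    refine (lintegral_union_le _ _ _).trans ((add_le_add h1 h2).trans_eq ?_)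
    rw [← ENNReal.ofReal_add (div_nonneg (by positivity) (by linarith))
      (div_nonneg (by positivity) (by linarith)), ← ENNReal.ofReal_coe_nnreal,
      ENNReal.ofReal_rpow_of_pos hx0, ← ENNReal.ofReal_mul hκ.le]
    congr 1
    ring

/-- The part `f₂` is integrated pointwise in `z`, whereas `f₁` enters only through its `L^s` norm `R
ω`. After Tonelli both reduce to the scalar integral over levels. Mere domination of `f` by `f₁ +
f₂` is needed, hence no adaptedness of the summands. -/
theorem lintegral_min_one_lintegral_minPow_le {Ω E : Type*} [MeasurableSpace Ω]
    [MeasurableSpace E] {P : Measure Ω} {μ : Measure E} [SFinite P] [SFinite μ] {s p : ℝ}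
    (hp : 1 < p) (hps : p < s) {f : Ω → E → ℝ≥0∞} {f₁ f₂ : Ω × E → ℝ≥0∞}
    (hf₁ : Measurable f₁) (hf₂ : Measurable f₂)
    (h : ∀ᵐ ω ∂P, ∀ᵐ z ∂μ, f ω z ≤ f₁ (ω, z) + f₂ (ω, z)) :
    ∫⁻ t in Set.Ioi (0 : ℝ),
        (∫⁻ ω, min 1 (∫⁻ z, minPow s (f ω z / ENNReal.ofReal t) ∂μ) ∂P) *
          ENNReal.ofReal (t ^ (p - 1)) ≤
      2 ^ s * ENNReal.ofReal (1 / (p - 1) + 1 / (s - p)) *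
        (∫⁻ ω, (∫⁻ z, f₁ (ω, z) ^ s ∂μ) ^ (p / s) ∂P + ∫⁻ ω, ∫⁻ z, f₂ (ω, z) ^ p ∂μ ∂P) := by
  have hs0 : 0 < s := by linarith
  have hs1 : 1 ≤ s := by linarith
  set κ := ENNReal.ofReal (1 / (p - 1) + 1 / (s - p))
  set R : Ω → ℝ≥0∞ := fun ω => (∫⁻ z, f₁ (ω, z) ^ s ∂μ) ^ (1 / s) with hR
  have hRm : Measurable R := (Measurable.lintegral_prod_right' (hf₁.pow_const s)).pow_const _
  have hΦ := measurable_minPow s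
  have hstep : ∀ t : ℝ, 0 < t →
      ∫⁻ ω, min 1 (∫⁻ z, minPow s (f ω z / ENNReal.ofReal t) ∂μ) ∂P ≤
        2 ^ s * (∫⁻ ω, minPow s (R ω / ENNReal.ofReal t) ∂P +
          ∫⁻ ω, ∫⁻ z, minPow s (f₂ (ω, z) / ENNReal.ofReal t) ∂μ ∂P) := by
    intro t ht
    have ht0 : ENNReal.ofReal t ≠ 0 := by simpa using ht
    rw [← lintegral_add_left (f := fun ω => minPow s (R ω / ENNReal.ofReal t))
      (hΦ.comp (hRm.div_const _)),
      ← lintegral_const_mul' _ _ (by simp)]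
    refine lintegral_mono_ae ?_
    filter_upwards [h] with ω hω
    have hm1 : Measurable fun z => f₁ (ω, z) := hf₁.comp measurable_prodMk_left
    set I₁ := ∫⁻ z, minPow s (f₁ (ω, z) / ENNReal.ofReal t) ∂μ
    set I₂ := ∫⁻ z, minPow s (f₂ (ω, z) / ENNReal.ofReal t) ∂μ
    have h1 : ∫⁻ z, minPow s (f ω z / ENNReal.ofReal t) ∂μ ≤ 2 ^ s * (I₁ + I₂) := by
      rw [← lintegral_add_left (f := fun z => minPow s (f₁ (ω, z) / ENNReal.ofReal t))
        (hΦ.comp (hm1.div_const _)),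
        ← lintegral_const_mul' _ _ (by simp)]
      refine lintegral_mono_ae ?_
      filter_upwards [hω] with z hz
      refine le_trans (minPow_mono hs0.le ?_) (minPow_add_le hs1 _ _)
      rw [← ENNReal.add_div]
      exact ENNReal.div_le_div_right hz _
    -- The term `I₁` is bounded by `(R ω / t)^s` alone; the cap at `1` is what improves this to
    -- `minPow`, making the integral over small `t` converge.
    have h2 : min 1 I₁ ≤ minPow s (R ω / ENNReal.ofReal t) := by
      refine le_trans (min_le_min_left _ ?_) (min_one_rpow_le_minPow hs1 _)
      calc I₁ ≤ ∫⁻ z, f₁ (ω, z) ^ s * (ENNReal.ofReal t ^ s)⁻¹ ∂μ := by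
            refine lintegral_mono fun z => (min_le_right _ _).trans_eq ?_
            rw [ENNReal.div_rpow_of_nonneg _ _ hs0.le, div_eq_mul_inv]
        _ = _ := by
            rw [lintegral_mul_const _ (hm1.pow_const s), ENNReal.div_rpow_of_nonneg _ _ hs0.le,
              ← ENNReal.rpow_mul, one_div_mul_cancel hs0.ne', ENNReal.rpow_one, div_eq_mul_inv]
    have h3 : (1 : ℝ≥0∞) ≤ 2 ^ s := ENNReal.one_le_rpow (by norm_num) hs0
    calc min 1 (∫⁻ z, minPow s (f ω z / ENNReal.ofReal t) ∂μ)
        ≤ min (2 ^ s * (1 + I₂)) (2 ^ s * (I₁ + I₂)) := by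
          refine min_le_min ?_ h1
          calc (1 : ℝ≥0∞) = 1 * 1 := (one_mul 1).symm
            _ ≤ 2 ^ s * (1 + I₂) := mul_le_mul' h3 le_self_add
      _ = 2 ^ s * (min 1 I₁ + I₂) := by rw [← mul_min, min_add_add_right]
      _ ≤ _ := by gcongr
  have hm : Measurable fun q : ℝ × Ω => minPow s (R q.2 / ENNReal.ofReal q.1) *
      ENNReal.ofReal (q.1 ^ (p - 1)) := by
    refine (hΦ.comp ?_).mul (by fun_prop)
    exact (hRm.comp measurable_snd).div (by fun_prop)
  have hm2 : Measurable fun q : ℝ × (Ω × E) => minPow s (f₂ q.2 / ENNReal.ofReal q.1) *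
      ENNReal.ofReal (q.1 ^ (p - 1)) := by
    refine (hΦ.comp ?_).mul (by fun_prop)
    exact (hf₂.comp measurable_snd).div (by fun_prop)
  have hA : ∫⁻ t in Set.Ioi (0 : ℝ), ∫⁻ ω, minPow s (R ω / ENNReal.ofReal t) *
      ENNReal.ofReal (t ^ (p - 1)) ∂P ≤ κ * ∫⁻ ω, (∫⁻ z, f₁ (ω, z) ^ s ∂μ) ^ (p / s) ∂P := by
    rw [lintegral_lintegral_swap hm.aemeasurable, ← lintegral_const_mul' _ _ ENNReal.ofReal_ne_top]
    refine lintegral_mono fun ω => (lintegral_minPow_mul_rpow_le hp hps (R ω)).trans_eq ?_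
    rw [hR, ← ENNReal.rpow_mul, one_div_mul_eq_div]
  have hB : ∫⁻ t in Set.Ioi (0 : ℝ), ∫⁻ q, minPow s (f₂ q / ENNReal.ofReal t) *
      ENNReal.ofReal (t ^ (p - 1)) ∂(P.prod μ) ≤ κ * ∫⁻ ω, ∫⁻ z, f₂ (ω, z) ^ p ∂μ ∂P := by
    rw [lintegral_lintegral_swap hm2.aemeasurable, ← lintegral_prod (fun q => f₂ q ^ p)
      (hf₂.pow_const p).aemeasurable, ← lintegral_const_mul' _ _ ENNReal.ofReal_ne_top]
    exact lintegral_mono fun q => lintegral_minPow_mul_rpow_le hp hps (f₂ q)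
  calc _ ≤ ∫⁻ t in Set.Ioi (0 : ℝ), 2 ^ s * (∫⁻ ω, minPow s (R ω / ENNReal.ofReal t) *
      ENNReal.ofReal (t ^ (p - 1)) ∂P + ∫⁻ q, minPow s (f₂ q / ENNReal.ofReal t) *
      ENNReal.ofReal (t ^ (p - 1)) ∂(P.prod μ)) := by
        refine setLIntegral_mono' measurableSet_Ioi fun t ht => ?_
        refine (mul_le_mul_left (hstep t ht) _).trans_eq ?_
        rw [lintegral_mul_const' _ _ ENNReal.ofReal_ne_top,
          lintegral_mul_const' _ _ ENNReal.ofReal_ne_top, mul_assoc, add_mul,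
          lintegral_prod (fun q => minPow s (f₂ q / ENNReal.ofReal t))
            (hΦ.comp (hf₂.div_const _)).aemeasurable]
    _ = 2 ^ s * ((∫⁻ t in Set.Ioi (0 : ℝ), ∫⁻ ω, minPow s (R ω / ENNReal.ofReal t) *
      ENNReal.ofReal (t ^ (p - 1)) ∂P) + ∫⁻ t in Set.Ioi (0 : ℝ), ∫⁻ q,
        minPow s (f₂ q / ENNReal.ofReal t) * ENNReal.ofReal (t ^ (p - 1)) ∂(P.prod μ)) := by
        rw [lintegral_const_mul' _ _ (by simp),
          lintegral_add_left hm.lintegral_prod_right']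
    _ ≤ _ := by
        rw [mul_assoc, mul_add κ]
        gcongr

end PoissonIntegral

namespace PoissonIntegral

/-! ### Moments of compensated Poisson random variables -/

/-- The constant in the moment bound for compensated Poisson variables. -/
noncomputable def poissonMomentBound (r : ℝ) : ℝ≥0 :=
  (1 + ∑' n : ℕ, ENNReal.ofReal ((n : ℝ) ^ r / n.factorial)).toNNReal

/-- From `x^m / m! ≤ exp x` with `m = ⌈r⌉`, the terms are dominated by a multiple of the exponential
series of `e`. -/
lemma tsum_rpow_div_factorial_ne_top {r : ℝ} (hr : 0 ≤ r) :
    ∑' n : ℕ, ENNReal.ofReal ((n : ℝ) ^ r / n.factorial) ≠ ∞ := by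
  set m := ⌈r⌉₊
  have hb : ∀ n : ℕ, (n : ℝ) ^ r / n.factorial ≤
      m.factorial * (Real.exp 1 ^ n / n.factorial) := by
    intro n
    rw [← mul_div_assoc]
    gcongr
    rcases Nat.eq_zero_or_pos n with rfl | hn
    · rcases hr.eq_or_lt with rfl | hr
      · simpa using! Nat.one_le_cast.2 (Nat.factorial_pos m)
      · simp [Real.zero_rpow hr.ne']
    have h1 : (1 : ℝ) ≤ n := Nat.one_le_cast.2 hn
    calc (n : ℝ) ^ r ≤ (n : ℝ) ^ (m : ℝ) := Real.rpow_le_rpow_of_exponent_le h1 (Nat.le_ceil r)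
      _ = (n : ℝ) ^ m := Real.rpow_natCast _ _
      _ ≤ m.factorial * Real.exp n := by
        have := Real.pow_div_factorial_le_exp (x := n) (Nat.cast_nonneg n) m
        rwa [div_le_iff₀' (by positivity)] at this
      _ = _ := by rw [← Real.exp_nat_mul, mul_one]
  have hsum : Summable fun n : ℕ => (m.factorial : ℝ) * (Real.exp 1 ^ n / n.factorial) :=
    (Real.summable_pow_div_factorial _).mul_left _
  exact (Summable.of_nonneg_of_le (fun n => by positivity) hb hsum).tsum_ofReal_ne_top

lemma coe_poissonMomentBound {r : ℝ} (hr : 0 ≤ r) : (poissonMomentBound r : ℝ≥0∞) =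
    1 + ∑' n : ℕ, ENNReal.ofReal ((n : ℝ) ^ r / n.factorial) :=
  ENNReal.coe_toNNReal (ENNReal.add_ne_top.2 ⟨ENNReal.one_ne_top, tsum_rpow_div_factorial_ne_top hr⟩)

/-- Every term is linear in `a`: the value `0` contributes at most `a^r ≤ a`, while for `n ≥ 1` one
has `a^n ≤ a` and `|n - a| ≤ n`. This uses `a ≤ 1`, which is why the cells are chosen small. -/
lemma lintegral_poissonMeasure_sub_rpow_le {r : ℝ} (hr : 1 ≤ r) {a : ℝ≥0} (ha : a ≤ 1) :
    ∫⁻ n : ℕ, ‖(n : ℝ) - a‖ₑ ^ r ∂(poissonMeasure a) ≤ poissonMomentBound r * a := by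
  have hr0 : 0 ≤ r := by linarith
  have ha' : (a : ℝ) ≤ 1 := ha
  rw [lintegral_countable', coe_poissonMomentBound hr0, add_mul, ← ENNReal.tsum_mul_right, one_mul]
  have hterm : ∀ n : ℕ, ‖(n : ℝ) - a‖ₑ ^ r * poissonMeasure a {n} ≤
      (if n = 0 then (a : ℝ≥0∞) else 0) + ENNReal.ofReal ((n : ℝ) ^ r / n.factorial) * a := by
    intro n
    rw [poissonMeasure_singleton, Real.enorm_eq_ofReal_abs,
      ENNReal.ofReal_rpow_of_nonneg (abs_nonneg _) hr0, ← ENNReal.ofReal_coe_nnreal,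
      ← ENNReal.ofReal_mul (by positivity), ← ENNReal.ofReal_mul (by positivity)]
    have hexp : Real.exp (-(a : ℝ)) ≤ 1 := Real.exp_le_one_iff.2 (by simp)
    rcases n with _ | n
    · refine le_trans (ENNReal.ofReal_le_ofReal ?_) (le_of_eq_of_le (if_pos rfl).symm le_self_add)
      simp only [Nat.cast_zero, zero_sub, abs_neg, pow_zero, mul_one, Nat.factorial_zero,
        Nat.cast_one, div_one, NNReal.abs_eq]
      calc (a : ℝ) ^ r * Real.exp (-(a : ℝ)) ≤ (a : ℝ) ^ (1 : ℝ) * 1 := by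
            refine mul_le_mul ?_ hexp (Real.exp_nonneg _) (by positivity)
            exact Real.rpow_le_rpow_of_exponent_ge' a.2 ha' zero_le_one hr
        _ = a := by simp
    · refine le_trans (ENNReal.ofReal_le_ofReal ?_) le_add_self
      have h1 : |((n + 1 : ℕ) : ℝ) - a| ≤ (n + 1 : ℕ) := by
        have : (0 : ℝ) ≤ a := a.2
        rw [abs_le]
        push_cast
        constructor <;> linarith [(Nat.cast_nonneg n : (0 : ℝ) ≤ n)]
      have h2 : (a : ℝ) ^ (n + 1) ≤ a := by
        rw [pow_succ]
        exact mul_le_of_le_one_left a.2 (pow_le_one₀ a.2 ha')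
      calc |((n + 1 : ℕ) : ℝ) - a| ^ r *
            (Real.exp (-(a : ℝ)) * (a : ℝ) ^ (n + 1) / (n + 1).factorial)
          ≤ ((n + 1 : ℕ) : ℝ) ^ r * (1 * a / (n + 1).factorial) := by gcongr
        _ = _ := by ring
  refine (ENNReal.tsum_le_tsum hterm).trans_eq ?_
  rw [ENNReal.tsum_add, tsum_ite_eq]

variable {Ω E : Type*} [MeasurableSpace E] {N : Ω → Measure E}

/-- The `σ`-algebra generated by the restriction of `N` to the complement of `D`. -/
abbrev sigmaOff (N : Ω → Measure E) (D : Set E) : MeasurableSpace Ω :=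
  ⨆ (B : Set E) (_ : MeasurableSet B) (_ : Disjoint B D),
    MeasurableSpace.comap (fun ω => N ω B) inferInstance

lemma measurable_sigmaOff {D B : Set E} (hB : MeasurableSet B) (hBD : Disjoint B D) :
    Measurable[sigmaOff N D] fun ω => N ω B :=
  (comap_measurable _).mono (le_iSup_of_le B (le_iSup_of_le hB (le_iSup_of_le hBD le_rfl))) le_rfl

lemma sigmaOff_anti {D D' : Set E} (h : D' ⊆ D) : sigmaOff N D ≤ sigmaOff N D' :=
  iSup_le fun _ => iSup_le fun hB => iSup_le fun hBD =>
    (measurable_sigmaOff hB (hBD.mono_right h)).comap_le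

variable [MeasurableSpace Ω] {P : Measure Ω} {μ : Measure E}

lemma IsPoissonRandomMeasure.measurable_compensated (hN : IsPoissonRandomMeasure N μ P)
    {B : Set E} (hB : MeasurableSet B) : Measurable (compensated N μ B) :=
  (hN.measurable B hB).ennreal_toReal.sub_const _

lemma IsPoissonRandomMeasure.lintegral_compensated_rpow_le (hN : IsPoissonRandomMeasure N μ P)
    {r : ℝ} (hr : 1 ≤ r) {B : Set E} (hB : MeasurableSet B) (hμB : μ B ≤ 1) :
    ∫⁻ ω, ‖compensated N μ B ω‖ₑ ^ r ∂P ≤ poissonMomentBound r * μ B := by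
  have hfin : μ B < ∞ := hμB.trans_lt ENNReal.one_lt_top
  have hg : Measurable fun x : ℝ≥0∞ => ‖x.toReal - (μ B).toReal‖ₑ ^ r := by fun_prop
  have h1 : ∫⁻ ω, ‖compensated N μ B ω‖ₑ ^ r ∂P =
      ∫⁻ x, ‖x.toReal - (μ B).toReal‖ₑ ^ r ∂(P.map fun ω => N ω B) :=
    (lintegral_map hg (hN.measurable B hB)).symm
  rw [h1, hN.poisson B hB hfin, lintegral_map hg (by fun_prop)]
  have h2 := lintegral_poissonMeasure_sub_rpow_le hr (a := (μ B).toNNReal)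
    (by rw [← ENNReal.coe_le_coe, ENNReal.coe_toNNReal hfin.ne]; exact_mod_cast hμB)
  rw [ENNReal.coe_toNNReal hfin.ne] at h2
  simpa using! h2

lemma IsPoissonRandomMeasure.memLp_compensated [IsProbabilityMeasure P]
    (hN : IsPoissonRandomMeasure N μ P) {B : Set E} (hB : MeasurableSet B) (hμB : μ B ≤ 1)
    {r : ℝ≥0∞} (hr : r ≠ ∞) : MemLp (compensated N μ B) r P := by
  -- The moment bound covers exponents from `1` on; smaller ones follow on a probability space.
  suffices h : MemLp (compensated N μ B) (max r 1) P from h.mono_exponent (le_max_left _ _)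
  refine ⟨(hN.measurable_compensated hB).aestronglyMeasurable, ?_⟩
  have h0 : max r 1 ≠ 0 := (lt_of_lt_of_le zero_lt_one (le_max_right r 1)).ne'
  have ht : max r 1 ≠ ∞ := by simp [hr]
  rw [eLpNorm_lt_top_iff_lintegral_rpow_enorm_lt_top h0 ht]
  refine (hN.lintegral_compensated_rpow_le ?_ hB hμB).trans_lt
    (ENNReal.mul_lt_top ENNReal.coe_lt_top (hμB.trans_lt ENNReal.one_lt_top))
  simpa using ENNReal.toReal_mono ht (le_max_right r 1)

lemma IsPoissonRandomMeasure.integral_compensated [IsProbabilityMeasure P]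
    (hN : IsPoissonRandomMeasure N μ P) {B : Set E} (hB : MeasurableSet B) (hμB : μ B < ∞) :
    ∫ ω, compensated N μ B ω ∂P = 0 := by
  have hI := hN.intensity B hB
  have hm := (hN.measurable B hB).aemeasurable (μ := P)
  have hfin : ∫⁻ ω, N ω B ∂P ≠ ∞ := by rw [hI]; exact hμB.ne
  unfold compensated
  rw [integral_sub (integrable_toReal_of_lintegral_ne_top hm hfin) (integrable_const _),
    integral_toReal hm (ae_lt_top' hm hfin), hI]
  simp

lemma IsPoissonRandomMeasure.ae_lt_top (hN : IsPoissonRandomMeasure N μ P) {B : Set E}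
    (hB : MeasurableSet B) (hμB : μ B < ∞) : ∀ᵐ ω ∂P, N ω B < ∞ :=
  ae_lt_top' (hN.measurable B hB).aemeasurable (by rw [hN.intensity B hB]; exact hμB.ne)

/-! ### Independence over disjoint regions -/

lemma sigmaOff_le (hN : IsPoissonRandomMeasure N μ P) (D : Set E) :
    sigmaOff N D ≤ ‹MeasurableSpace Ω› :=
  iSup_le fun B => iSup_le fun hB => iSup_le fun _ => (hN.measurable B hB).comap_le

lemma IsPoissonRandomMeasure.iIndepFun_of_fintype (hN : IsPoissonRandomMeasure N μ P)
    {ι : Type*} [Finite ι] {B : ι → Set E} (hB : ∀ i, MeasurableSet (B i))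
    (hd : Pairwise (Function.onFun Disjoint B)) : iIndepFun (fun i ω => N ω (B i)) P := by
  obtain ⟨n, ⟨e⟩⟩ := Finite.exists_equiv_fin ι
  have h := hN.indep n (fun i => B (e.symm i)) (fun i => hB _)
    (fun i j hij => hd (e.symm.injective.ne hij))
  have := h.precomp e.injective
  simpa using this

/-- The atom of the algebra of sets generated by `B i`, `i ∈ S`, with sign pattern `ε`. -/
def atom {ι : Type*} (B : ι → Set E) (S : Finset ι) (ε : S → Bool) : Set E :=
  ⋂ i : S, if ε i then B i else (B i)ᶜ

/-- The sets `B i` may overlap, so they are cut into the atoms of the algebra they generate. Each `N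
(B i)` is a sum of masses of atoms, and these are jointly independent of `N D`. -/
lemma IsPoissonRandomMeasure.indep_iSup_finset (hN : IsPoissonRandomMeasure N μ P)
    {ι : Type*} {B : ι → Set E} (hB : ∀ i, MeasurableSet (B i)) {D : Set E}
    (hD : MeasurableSet D) (hBD : ∀ i, Disjoint (B i) D) (S : Finset ι) :
    Indep (⨆ i ∈ S, MeasurableSpace.comap (fun ω => N ω (B i)) inferInstance)
      (MeasurableSpace.comap (fun ω => N ω D) inferInstance) P := by
  classical
  -- `none` stands for `D`. Removing `D` matters for the atom outside all `B i`, which would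
  -- otherwise contain it.
  let F : Option (S → Bool) → Set E := fun o => o.elim D fun ε => atom B S ε \ D
  have hatom : ∀ ε, MeasurableSet (atom B S ε) := fun ε => MeasurableSet.iInter fun i => by
    split_ifs
    exacts [hB _, (hB _).compl]
  have hF : ∀ o, MeasurableSet (F o) := by
    rintro (_ | ε)
    exacts [hD, (hatom ε).diff hD]
  have hatomd : ∀ ε ε', ε ≠ ε' → Disjoint (atom B S ε) (atom B S ε') := by
    intro ε ε' h
    obtain ⟨i, hi⟩ := Function.ne_iff.1 h
    refine Set.disjoint_left.2 fun z hz hz' => ?_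
    have h1 := Set.mem_iInter.1 hz i
    have h2 := Set.mem_iInter.1 hz' i
    cases h3 : ε i <;> cases h4 : ε' i <;> simp_all
  have hFd : Pairwise (Function.onFun Disjoint F) := by
    rintro (_ | ε) (_ | ε') h
    · exact absurd rfl h
    · exact Set.disjoint_sdiff_right
    · exact Set.disjoint_sdiff_left
    · exact (hatomd ε ε' fun h' => h (by rw [h'])).mono Set.sdiff_subset Set.sdiff_subset
  have hind := hN.iIndepFun_of_fintype hF hFd
  have h := indep_iSup_of_disjoint (fun o => (hN.measurable _ (hF o)).comap_le) hind
    (S := Set.range some) (T := {none}) (by simp)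
  rw [iSup_singleton] at h
  refine indep_of_indep_of_le_left h (iSup₂_le fun i hi => ?_)
  have hN' : ∀ ω, N ω (B i) = ∑ ε ∈ Finset.univ.filter fun ε : S → Bool => ε ⟨i, hi⟩ = true,
      N ω (F (some ε)) := by
    intro ω
    rw [← measure_biUnion_finset]
    · congr 1
      ext z
      simp only [Finset.mem_filter, Finset.mem_univ, true_and, Set.mem_iUnion, exists_prop]
      constructor
      · intro hz
        refine ⟨fun j => decide (z ∈ B j), by simpa using hz, ?_, Set.disjoint_left.1 (hBD i) hz⟩
        refine Set.mem_iInter.2 fun j => ?_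
        by_cases hj : z ∈ B j <;> simp [hj]
      · rintro ⟨ε, hε, hz, -⟩
        have := Set.mem_iInter.1 hz ⟨i, hi⟩
        simpa [hε] using this
    · exact fun ε _ ε' _ h => hFd fun h' => h (Option.some_injective _ h')
    · exact fun ε _ => hF _
  have : Measurable[⨆ o ∈ Set.range (some : (S → Bool) → _),
      MeasurableSpace.comap (fun ω => N ω (F o)) inferInstance] fun ω => N ω (B i) := by
    simp_rw [hN']
    exact Finset.measurable_fun_sum _ fun ε _ => (comap_measurable _).mono
      (le_iSup₂_of_le (some ε) ⟨ε, rfl⟩ le_rfl) le_rfl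
  exact this.comap_le

/-- The σ-algebras of finite families are directed under union, so independence passes from them to
their supremum. -/
lemma IsPoissonRandomMeasure.indep_sigmaOff [IsProbabilityMeasure P]
    (hN : IsPoissonRandomMeasure N μ P) {D : Set E} (hD : MeasurableSet D) :
    Indep (sigmaOff N D) (MeasurableSpace.comap (fun ω => N ω D) inferInstance) P := by
  let ι := {B : Set E // MeasurableSet B ∧ Disjoint B D}
  have h := indep_iSup_of_directed_le (μ := P)
    (fun S : Finset ι => hN.indep_iSup_finset (B := fun i : ι => i.1) (fun i => i.2.1) hD
      (fun i => i.2.2) S)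
    (fun S => iSup₂_le fun i _ => (hN.measurable _ i.2.1).comap_le)
    (hN.measurable D hD).comap_le (by
      classical
      intro S T
      exact ⟨S ∪ T, biSup_mono fun i hi => Finset.mem_union_left _ hi,
        biSup_mono fun i hi => Finset.mem_union_right _ hi⟩)
  refine indep_of_indep_of_le_left h (iSup_le fun B => iSup_le fun hB => iSup_le fun hBD => ?_)
  exact le_iSup_of_le {⟨B, hB, hBD⟩} (le_iSup₂_of_le (⟨B, hB, hBD⟩ : ι)
    (Finset.mem_singleton_self _) le_rfl)

end PoissonIntegral

namespace PoissonIntegral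

/-! ### The filtration of the past -/

section Past

variable {Ω E : Type*} [MeasurableSpace E] [MeasurableSpace Ω] {N : Ω → Measure E} {P : Measure Ω}
  {μ : Measure E}

/-- The filtration generated by `N` off the sets `D k, D (k + 1), …` still to come. -/
def pastFiltration (hN : IsPoissonRandomMeasure N μ P) (D : ℕ → Set E) :
    Filtration ℕ ‹MeasurableSpace Ω› where
  seq k := sigmaOff N (⋃ i ∈ Set.Ici k, D i)
  mono' _ _ h := sigmaOff_anti (Set.biUnion_subset_biUnion_left (Set.Ici_subset_Ici.2 h))
  le' _ := sigmaOff_le hN _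

lemma isNoise_compensated [IsProbabilityMeasure P] (hN : IsPoissonRandomMeasure N μ P)
    {D : ℕ → Set E} (hD : ∀ k, MeasurableSet (D k)) (hd : Pairwise (Function.onFun Disjoint D))
    (hμ : ∀ k, μ (D k) ≤ 1) :
    IsNoise (pastFiltration hN D) (fun k => compensated N μ (D k)) P where
  measurable k := by
    have h : Measurable[pastFiltration hN D (k + 1)] fun ω => N ω (D k) := by
      refine measurable_sigmaOff (hD k) ?_
      simp only [Set.disjoint_iUnion_right, Set.mem_Ici]
      exact fun i hi => hd (by omega)
    exact h.ennreal_toReal.sub_const _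
  indep k := by
    have h := (hN.indep_sigmaOff (hD k)).symm
    have h1 : MeasurableSpace.comap (compensated N μ (D k)) inferInstance ≤
        MeasurableSpace.comap (fun ω => N ω (D k)) inferInstance :=
      ((comap_measurable (fun ω => N ω (D k))).ennreal_toReal.sub_const _).comap_le
    exact indep_of_indep_of_le_left (indep_of_indep_of_le_right h
      (sigmaOff_anti (Set.subset_biUnion_of_mem (u := D) (Set.mem_Ici.2 le_rfl)))) h1
  memLp k r hr := hN.memLp_compensated (hD k) (hμ k) hr
  integral_eq_zero k := hN.integral_compensated (hD k) ((hμ k).trans_lt ENNReal.one_lt_top)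

end Past

/-! ### Time grids -/

/-- Every finite set of times is contained in the range of an arbitrarily fine grid. -/
lemma exists_grid (S : Finset ℝ≥0) {δ : ℝ≥0} (hδ : 0 < δ) :
    ∃ τ : ℕ → ℝ≥0, Monotone τ ∧ τ 0 = 0 ∧ (∀ q, τ (q + 1) ≤ τ q + δ) ∧ ∀ x ∈ S, ∃ q, τ q = x := by
  -- Unboundedness of the grid is added to the induction: it guarantees an index at which a new
  -- point can be inserted.
  suffices h : ∃ τ : ℕ → ℝ≥0, Monotone τ ∧ τ 0 = 0 ∧ (∀ q, τ (q + 1) ≤ τ q + δ) ∧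
      (∀ x, ∃ q, x ≤ τ q) ∧ ∀ x ∈ S, ∃ q, τ q = x by
    obtain ⟨τ, h1, h2, h3, -, h4⟩ := h
    exact ⟨τ, h1, h2, h3, h4⟩
  induction S using Finset.induction_on with
  | empty =>
    refine ⟨fun q => q * δ, fun q r h => by dsimp only; gcongr, by simp, fun q => ?_, fun x => ?_,
      by simp⟩
    · push_cast; rw [add_mul, one_mul]
    · obtain ⟨q, hq⟩ := exists_nat_ge (x / δ)
      exact ⟨q, (div_le_iff₀ hδ).1 hq⟩
  | insert a S _ ih =>
    obtain ⟨τ, hm, h0, hg, hu, hS⟩ := ih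
    have hs : ∀ q, τ q ≤ τ (q + 1) := fun q => hm (Nat.le_succ q)
    -- This inserts `a` at the first index where `τ` reaches it and shifts the later points by one.
    -- At `q = 0` the truncated subtraction is harmless because `τ 0 = 0`.
    set σ : ℕ → ℝ≥0 := fun q => min (τ q) (max a (τ (q - 1))) with hσ
    have hrange : ∀ q, ∃ r, σ r = τ q := by
      intro q
      rcases le_total (τ q) a with h | h
      · exact ⟨q, min_eq_left (h.trans (le_max_left _ _))⟩
      · refine ⟨q + 1, ?_⟩
        simp only [hσ, Nat.add_sub_cancel, max_eq_right h, min_eq_right (hs q)]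
    refine ⟨σ, fun q r h => min_le_min (hm h) (max_le_max le_rfl (hm (by omega))), by simp [hσ, h0],
      fun q => ?_, fun x => ?_, fun x hx => ?_⟩
    · simp only [hσ, Nat.add_sub_cancel]
      rcases le_total (τ q) a with h | h
      · rw [max_eq_left h, min_eq_left (h.trans (le_max_left _ _))]
        exact (min_le_left _ _).trans (hg q)
      · rw [max_eq_right h, min_eq_right (hs q)]
        rcases Nat.eq_zero_or_pos q with rfl | hq
        · simp [h0]
        · have := hg (q - 1)
          rw [Nat.sub_add_cancel hq] at this
          refine this.trans (add_le_add_left (le_min ?_ (le_max_right _ _)) _)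
          exact hm (Nat.sub_le _ _)
    · obtain ⟨q, hq⟩ := hu x
      obtain ⟨r, hr⟩ := hrange q
      exact ⟨r, hr ▸ hq⟩
    · rcases Finset.mem_insert.1 hx with rfl | hx
      · classical
        let H := hu x
        refine ⟨Nat.find H, ?_⟩
        have h1 := Nat.find_spec H
        simp only [hσ]
        rcases Nat.eq_zero_or_pos (Nat.find H) with hz | hz
        · rw [hz, h0] at h1
          rw [hz, h0, nonpos_iff_eq_zero.1 h1]
          simp
        · have h2 : τ (Nat.find H - 1) < x := not_le.1 (Nat.find_min H (by omega))
          rw [max_eq_left h2.le, min_eq_right h1]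
      · obtain ⟨q, hq⟩ := hS x hx
        obtain ⟨r, hr⟩ := hrange q
        exact ⟨r, hr.trans hq⟩

lemma timeMeasure_Ioc (a b : ℝ≥0) : timeMeasure (Set.Ioc a b) = (b - a : ℝ≥0) := by
  have he : MeasurableEmbedding fun t : ℝ≥0 => (t : ℝ) :=
    MeasurableEmbedding.subtype_coe measurableSet_Ici
  rw [timeMeasure, he.comap_apply]
  have : (fun t : ℝ≥0 => (t : ℝ)) '' Set.Ioc a b = Set.Ioc (a : ℝ) b := by
    ext x
    constructor
    · rintro ⟨t, ht, rfl⟩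
      exact ⟨ht.1, ht.2⟩
    · intro hx
      exact ⟨⟨x, a.2.trans hx.1.le⟩, ⟨hx.1, hx.2⟩, rfl⟩
  rw [this, Real.volume_Ioc, NNReal.sub_def]
  rfl

lemma timeProd_Ioc_prod {J : Type*} [MeasurableSpace J] (ν : Measure J) [SFinite ν] (a b : ℝ≥0)
    (A : Set J) : timeProd ν (Set.Ioc a b ×ˢ A) = (b - a : ℝ≥0) * ν A := by
  rw [timeProd, Measure.prod_prod, timeMeasure_Ioc]

lemma sum_range_mul {M : Type*} [AddCommMonoid M] (m : ℕ) (f : ℕ → ℕ → M) (q : ℕ) :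
    ∑ k ∈ Finset.range (q * m), f (k / m) (k % m) =
      ∑ r ∈ Finset.range q, ∑ j ∈ Finset.range m, f r j := by
  induction q with
  | zero => simp
  | succ q ih =>
    rw [Nat.succ_mul, Finset.sum_range_add, ih, Finset.sum_range_succ]
    congr 1
    refine Finset.sum_congr rfl fun j hj => ?_
    have hj := Finset.mem_range.1 hj
    rw [Nat.mul_comm q m, Nat.mul_add_div (by omega), Nat.mul_add_mod, Nat.div_eq_of_lt hj,
      Nat.mod_eq_of_lt hj, add_zero]

end PoissonIntegral

namespace PoissonIntegral

/-! ### Simple processes along a time grid -/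

section Compensated

variable {Ω E : Type*} [MeasurableSpace E] {N : Ω → Measure E} {μ : Measure E}

lemma compensated_empty (ω : Ω) : compensated N μ ∅ ω = 0 := by simp [compensated]

lemma compensated_union {A B : Set E} (hB : MeasurableSet B) (hAB : Disjoint A B) {ω : Ω}
    (hA' : N ω A ≠ ∞) (hB' : N ω B ≠ ∞) (hμA : μ A ≠ ∞) (hμB : μ B ≠ ∞) :
    compensated N μ (A ∪ B) ω = compensated N μ A ω + compensated N μ B ω := by
  unfold compensated
  rw [measure_union hAB hB, measure_union hAB hB, ENNReal.toReal_add hA' hB',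
    ENNReal.toReal_add hμA hμB]
  ring

end Compensated

namespace SimpleProcess

variable {𝕜 : Type k} {X : Type u} [RCLike 𝕜]
  {Ω : Type v} {J : Type w}
  [MeasurableSpace Ω] [MeasurableSpace J] {P : Measure Ω} {ν : Measure J}
  {N : Ω → Measure (ℝ≥0 × J)}

/-- The set `(t, t'] × (A j ∩ B)`. -/
def cell (φ : SimpleProcess 𝕜 X P ν N) (B : Set J) (t t' : ℝ≥0) (j : ℕ) : Set (ℝ≥0 × J) :=
  if h : j < φ.m then Set.Ioc t t' ×ˢ (φ.A ⟨j, h⟩ ∩ B) else ∅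

/-- The cells along the time grid `τ`, as a sequence. -/
def gridCell (φ : SimpleProcess 𝕜 X P ν N) (B : Set J) (τ : ℕ → ℝ≥0) (k : ℕ) : Set (ℝ≥0 × J) :=
  -- The quotient is the time step and the remainder the jump set; if `φ.m = 0`, all cells are
  -- empty.
  φ.cell B (τ (k / φ.m)) (τ (k / φ.m + 1)) (k % φ.m)

/-- The process with its coefficients replaced by strongly measurable versions. -/
noncomputable def measurableVersion (φ : SimpleProcess 𝕜 X P ν N) : SimpleProcess 𝕜 X P ν N :=
  { φ with
    F := fun i j k => (φ.F_adapted i j k).mk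
    F_memLp := fun i j k => (φ.F_memLp i j k).ae_eq (φ.F_adapted i j k).ae_eq_mk
    F_adapted := fun i j k =>
      ((φ.F_adapted i j k).stronglyMeasurable_mk).aestronglyMeasurable }

variable (φ : SimpleProcess 𝕜 X P ν N) {B : Set J} {τ : ℕ → ℝ≥0}

lemma measurableSet_cell (hB : MeasurableSet B) (t t' : ℝ≥0) (j : ℕ) :
    MeasurableSet (φ.cell B t t' j) := by
  unfold cell
  split_ifs with h
  · exact measurableSet_Ioc.prod ((φ.A_measurable _).inter hB)
  · exact MeasurableSet.empty

lemma disjoint_gridCell (hτ : Monotone τ) : Pairwise (Function.onFun Disjoint (φ.gridCell B τ)) := by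
  have key : ∀ a b, a < b → Disjoint (φ.gridCell B τ a) (φ.gridCell B τ b) := by
    intro a b hab
    unfold gridCell cell
    split_ifs with ha hb
    · rcases (Nat.div_le_div_right (c := φ.m) hab.le).eq_or_lt with h | h
      · have hmod : a % φ.m ≠ b % φ.m := fun h' => hab.ne (by
          rw [← Nat.div_add_mod a φ.m, ← Nat.div_add_mod b φ.m, h, h'])
        exact Set.disjoint_prod.2 (Or.inr ((φ.A_disjoint (Fin.ne_of_val_ne hmod
          : (⟨_, ha⟩ : Fin φ.m) ≠ ⟨_, hb⟩)).mono Set.inter_subset_left Set.inter_subset_left))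
      · refine Set.disjoint_prod.2 (Or.inl (Set.disjoint_left.2 fun z hz hz' => ?_))
        exact absurd hz'.1 (not_lt.2 (hz.2.trans (hτ h)))
    all_goals simp
  intro a b hab
  rcases lt_or_gt_of_ne hab with h | h
  exacts [key a b h, (key b a h).symm]

/-- The generators of the σ-algebra at time `t` live on strips ending by `t`, hence before every
cell of index at least `k`. This makes coefficients of the process adapted to `pastFiltration`. -/
lemma poissonSigma_le_sigmaOff (hτ : Monotone τ) {t : ℝ≥0} {k : ℕ} (h : t ≤ τ (k / φ.m)) :
    poissonSigma N t ≤ sigmaOff N (⋃ i ∈ Set.Ici k, φ.gridCell B τ i) := by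
  refine iSup_le fun r => iSup_le fun u => iSup_le fun A => iSup_le fun _ => iSup_le fun hu =>
    iSup_le fun hA => (measurable_sigmaOff (measurableSet_Ioc.prod hA) ?_).comap_le
  simp only [Set.disjoint_iUnion_right, Set.mem_Ici]
  intro i hi
  unfold gridCell cell
  split_ifs with hm
  · refine Set.disjoint_prod.2 (Or.inl (Set.disjoint_left.2 fun z hz hz' => ?_))
    exact absurd hz'.1 (not_lt.2 (hz.2.trans (hu.trans (h.trans (hτ (Nat.div_le_div_right hi))))))
  · simp

lemma timeProd_gridCell_le_one [SFinite ν] {δ : ℝ≥0} (hg : ∀ q, τ (q + 1) ≤ τ q + δ)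
    (hδ : ∀ j, δ * ν (φ.A j) ≤ 1) (k : ℕ) : timeProd ν (φ.gridCell B τ k) ≤ 1 := by
  unfold gridCell cell
  split_ifs with h
  · rw [timeProd_Ioc_prod]
    refine le_trans (mul_le_mul' ?_ (measure_mono Set.inter_subset_left)) (hδ ⟨_, h⟩)
    exact ENNReal.coe_le_coe.2 (tsub_le_iff_left.2 (hg _))
  · simp

variable [NormedAddCommGroup X] [NormedSpace 𝕜 X]

/-- The coefficient of the process on `(t i, t (i + 1)] × A j`. -/
noncomputable def coeff (i : Fin φ.l) (j : Fin φ.m) (ω : Ω) : X :=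
  ∑ k, φ.F i j k ω • φ.x i j k

/-- The coefficient of the process on `A j` just after time `t`. -/
noncomputable def coeffAt (t : ℝ≥0) (j : ℕ) (ω : Ω) : X :=
  if h : j < φ.m then
    ∑ i, if φ.t i.castSucc ≤ t ∧ t < φ.t i.succ then φ.coeff i ⟨j, h⟩ ω else 0
  else 0

/-- The coefficients of the process as a sequence along the time grid `τ`. -/
noncomputable def gridCoeff (τ : ℕ → ℝ≥0) (k : ℕ) : Ω → X :=
  φ.coeffAt (τ (k / φ.m)) (k % φ.m)

lemma memLp_coeff [IsFiniteMeasure P] (i : Fin φ.l) (j : Fin φ.m) : MemLp (φ.coeff i j) ∞ P :=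
  memLp_finsetSum _ fun k _ => (memLp_top_const (φ.x i j k)).smul (φ.F_memLp i j k)

lemma isBoundedAdapted_gridCoeff [IsFiniteMeasure P] {μ : Measure (ℝ≥0 × J)}
    (hN : IsPoissonRandomMeasure N μ P) (hτ : Monotone τ)
    (hF : ∀ i j k, StronglyMeasurable[poissonSigma N (φ.t i.castSucc)] (φ.F i j k)) :
    IsBoundedAdapted (pastFiltration hN (φ.gridCell B τ)) (φ.gridCoeff τ) P where
  stronglyMeasurable k := by
    unfold gridCoeff coeffAt
    split_ifs with h
    · refine Finset.stronglyMeasurable_fun_sum _ fun i _ => ?_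
      split_ifs with ht
      · refine Finset.stronglyMeasurable_fun_sum _ fun n _ => ?_
        exact ((hF i _ n).mono (φ.poissonSigma_le_sigmaOff hτ ht.1)).smul_const _
      · exact stronglyMeasurable_const
    · exact stronglyMeasurable_const
  memLp k := by
    unfold gridCoeff coeffAt
    split_ifs with h
    · refine memLp_finsetSum _ fun i _ => ?_
      split_ifs with ht
      · exact φ.memLp_coeff i _
      · exact memLp_const _
    · exact memLp_const _

/-- Along a grid containing its jump times the process is constant on the grid cells. -/
lemma restrictJump_toFun_eq_gridCoeff (ht : ∀ i, ∃ q, τ q = φ.t i) (hτ : Monotone τ) {ω : Ω}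
    {k : ℕ} {z : ℝ≥0 × J} (hz : z ∈ φ.gridCell B τ k) :
    restrictJump φ.toFun B ω z = φ.gridCoeff τ k ω := by
  unfold gridCell cell at hz
  split_ifs at hz with h
  · obtain ⟨hz1, hzA, hzB⟩ := hz
    have hmem : z ∈ (Set.univ : Set ℝ≥0) ×ˢ B := ⟨Set.mem_univ _, hzB⟩
    rw [restrictJump, Set.indicator_of_mem hmem, toFun, gridCoeff, coeffAt, dif_pos h]
    refine Finset.sum_congr rfl fun i _ => ?_
    -- The jump times are grid points, so no cell straddles one of them.
    have hi : z.1 ∈ Set.Ioc (φ.t i.castSucc) (φ.t i.succ) ↔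
        φ.t i.castSucc ≤ τ (k / φ.m) ∧ τ (k / φ.m) < φ.t i.succ := by
      obtain ⟨q₁, hq₁⟩ := ht i.castSucc
      obtain ⟨q₂, hq₂⟩ := ht i.succ
      constructor
      · intro hi
        refine ⟨?_, hz1.1.trans_le hi.2⟩
        by_contra hcon
        rw [← hq₁] at hcon hi
        have : k / φ.m + 1 ≤ q₁ := by
          by_contra hq
          exact hcon (hτ (by omega))
        exact absurd hi.1 (not_lt.2 (hz1.2.trans (hτ this)))
      · rintro ⟨h1, h2⟩
        refine ⟨h1.trans_lt hz1.1, ?_⟩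
        rw [← hq₂] at h2 ⊢
        refine hz1.2.trans (hτ ?_)
        by_contra hq
        exact absurd h2 (not_lt.2 (hτ (by omega)))
    rw [Finset.sum_eq_single ⟨k % φ.m, h⟩]
    · split_ifs with hc
      · refine Finset.sum_congr rfl fun n _ => ?_
        rw [Set.indicator_of_mem (show z ∈ _ ×ˢ _ from ⟨hi.2 hc, hzA⟩)]
      · refine Finset.sum_eq_zero fun n _ => ?_
        rw [Set.indicator_of_notMem (fun hz' => hc (hi.1 hz'.1))]
    · intro j _ hj
      refine Finset.sum_eq_zero fun n _ => ?_
      rw [Set.indicator_of_notMem]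
      exact fun hz' => Set.disjoint_left.1 (φ.A_disjoint hj) hz'.2 hzA
    · simp
  · exact absurd hz (Set.notMem_empty _)

/-- The process is constant on the disjoint cells, so the left side is an integral over their union.
An arbitrary `Ψ` serves the powers `s` and `p` as well as `minPow`. -/
lemma sum_measure_gridCell_mul_le (ht : ∀ i, ∃ q, τ q = φ.t i) (hτ : Monotone τ)
    (hB : MeasurableSet B) (Ψ : ℝ≥0∞ → ℝ≥0∞) (n : ℕ) (ω : Ω) :
    ∑ k ∈ Finset.range n, timeProd ν (φ.gridCell B τ k) * Ψ ‖φ.gridCoeff τ k ω‖ₑ ≤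
      ∫⁻ z, Ψ ‖restrictJump φ.toFun B ω z‖ₑ ∂(timeProd ν) := by
  have hm : ∀ k, MeasurableSet (φ.gridCell B τ k) := fun k => φ.measurableSet_cell hB _ _ _
  calc ∑ k ∈ Finset.range n, timeProd ν (φ.gridCell B τ k) * Ψ ‖φ.gridCoeff τ k ω‖ₑ
      = ∑ k ∈ Finset.range n, ∫⁻ z in φ.gridCell B τ k,
          Ψ ‖restrictJump φ.toFun B ω z‖ₑ ∂(timeProd ν) := by
        refine Finset.sum_congr rfl fun k _ => ?_
        rw [setLIntegral_congr_fun (hm k) fun z hz => by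
          rw [φ.restrictJump_toFun_eq_gridCoeff ht hτ hz], setLIntegral_const, mul_comm]
    _ = ∫⁻ z in ⋃ k ∈ Finset.range n, φ.gridCell B τ k,
          Ψ ‖restrictJump φ.toFun B ω z‖ₑ ∂(timeProd ν) :=
        (lintegral_biUnion_finset (fun a _ b _ hab => φ.disjoint_gridCell hτ hab)
          (fun k _ => hm k) _).symm
    _ ≤ _ := setLIntegral_le_lintegral _ _

end SimpleProcess

end PoissonIntegral

namespace PoissonIntegral

/-! ### Discretization of the stochastic integral -/

/-- Continuity from above, needed for both `N ω` and its intensity; it is the source of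
right-continuity of the paths. -/
lemma tendsto_measure_Ioc_min_prod {J : Type*} [MeasurableSpace J] (ρ : Measure (ℝ≥0 × J))
    {C : Set J} (hC : MeasurableSet C) {b t : ℝ≥0} (hρ : ρ (Set.Ioc 0 b ×ˢ C) ≠ ∞)
    {u : ℕ → ℝ≥0} (hu : Antitone u) (hut : ∀ n, t ≤ u n)
    (hlim : Filter.Tendsto u Filter.atTop (nhds t)) :
    Filter.Tendsto (fun n => (ρ (Set.Ioc 0 (min b (u n)) ×ˢ C)).toReal) Filter.atTop
      (nhds (ρ (Set.Ioc 0 (min b t) ×ˢ C)).toReal) := by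
  have hfin : ∀ x, ρ (Set.Ioc 0 (min b x) ×ˢ C) ≠ ∞ := fun x =>
    ne_top_of_le_ne_top hρ (measure_mono (Set.prod_mono
      (Set.Ioc_subset_Ioc_right (min_le_left _ _)) subset_rfl))
  refine (ENNReal.tendsto_toReal (hfin t)).comp ?_
  have h := tendsto_measure_iInter_atTop (μ := ρ) (s := fun n => Set.Ioc 0 (min b (u n)) ×ˢ C)
    (fun n => (measurableSet_Ioc.prod hC).nullMeasurableSet)
    (fun m n hmn => Set.prod_mono (Set.Ioc_subset_Ioc_right (min_le_min le_rfl (hu hmn)))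
      subset_rfl) ⟨0, hfin _⟩
  have hInter : ⋂ n, Set.Ioc 0 (min b (u n)) ×ˢ C = Set.Ioc 0 (min b t) ×ˢ C := by
    ext z
    simp only [Set.mem_iInter, Set.mem_prod, Set.mem_Ioc, le_min_iff]
    constructor
    · intro hz
      exact ⟨⟨(hz 0).1.1, (hz 0).1.2.1, ge_of_tendsto' hlim fun n => (hz n).1.2.2⟩, (hz 0).2⟩
    · rintro ⟨⟨h1, h2, h3⟩, h4⟩ n
      exact ⟨⟨h1, h2, h3.trans (hut n)⟩, h4⟩
  rwa [hInter] at h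

namespace SimpleProcess

variable {𝕜 : Type k} {X : Type u} [RCLike 𝕜]
  {Ω : Type v} {J : Type w}
  [MeasurableSpace Ω] [MeasurableSpace J] {P : Measure Ω} {ν : Measure J}
  {N : Ω → Measure (ℝ≥0 × J)} (φ : SimpleProcess 𝕜 X P ν N) {B : Set J} {τ : ℕ → ℝ≥0} {ω : Ω}

lemma t_le_last (i : Fin (φ.l + 1)) : φ.t i ≤ φ.t (Fin.last _) :=
  φ.t_strictMono.monotone (Fin.le_last i)

/-- `N` gives finite mass to the support of the process. -/
def FiniteAt (φ : SimpleProcess 𝕜 X P ν N) (ω : Ω) : Prop :=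
  ∀ j, N ω (Set.Ioc 0 (φ.t (Fin.last _)) ×ˢ φ.A j) ≠ ∞

variable {φ} in
lemma FiniteAt.ne_top (h : φ.FiniteAt ω) {a b : ℝ≥0} (hb : b ≤ φ.t (Fin.last _)) (j : Fin φ.m) :
    N ω (Set.Ioc a b ×ˢ (φ.A j ∩ B)) ≠ ∞ :=
  ne_top_of_le_ne_top (h j) (measure_mono (Set.prod_mono
    (Set.Ioc_subset_Ioc zero_le hb) Set.inter_subset_left))

lemma timeProd_ne_top [SFinite ν] (a b : ℝ≥0) (j : Fin φ.m) :
    timeProd ν (Set.Ioc a b ×ˢ (φ.A j ∩ B)) ≠ ∞ := by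
  rw [timeProd_Ioc_prod]
  exact ENNReal.mul_ne_top ENNReal.coe_ne_top
    (ne_top_of_le_ne_top (φ.A_finite j).ne (measure_mono Set.inter_subset_left))

lemma ae_finiteAt [SFinite ν] (hN : IsPoissonRandomMeasure N (timeProd ν) P) :
    ∀ᵐ ω ∂P, φ.FiniteAt ω := by
  refine ae_all_iff.2 fun j => ?_
  have h := φ.timeProd_ne_top (B := Set.univ) 0 (φ.t (Fin.last _)) j
  rw [Set.inter_univ] at h
  exact (hN.ae_lt_top (measurableSet_Ioc.prod (φ.A_measurable j)) h.lt_top).mono fun _ => ne_of_lt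

/-- Since `toReal` sends `∞` to `0`, additivity needs finite masses; this is the purpose of
`FiniteAt`, which holds almost surely. -/
lemma compensated_Ioc_add [SFinite ν] (hB : MeasurableSet B) (h : φ.FiniteAt ω) {a b c : ℝ≥0}
    (hab : a ≤ b) (hbc : b ≤ c) (hc : c ≤ φ.t (Fin.last _)) (j : Fin φ.m) :
    compensated N (timeProd ν) (Set.Ioc a c ×ˢ (φ.A j ∩ B)) ω =
      compensated N (timeProd ν) (Set.Ioc a b ×ˢ (φ.A j ∩ B)) ω +
      compensated N (timeProd ν) (Set.Ioc b c ×ˢ (φ.A j ∩ B)) ω := by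
  rw [← compensated_union (measurableSet_Ioc.prod ((φ.A_measurable j).inter hB))
    (Set.disjoint_prod.2 (Or.inl (Set.Ioc_disjoint_Ioc_of_le le_rfl)))
    (h.ne_top (hbc.trans hc) j) (h.ne_top hc j) (φ.timeProd_ne_top _ _ j)
    (φ.timeProd_ne_top _ _ j), ← Set.union_prod, Set.Ioc_union_Ioc_eq_Ioc hab hbc]

variable [NormedAddCommGroup X] [NormedSpace 𝕜 X]

/-- There are finitely many coefficients, so one null set serves all `B`, all times and all points.
-/
lemma ae_measurableVersion_eq : ∀ᵐ ω ∂P,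
    (∀ B t, φ.measurableVersion.integral B t ω = φ.integral B t ω) ∧
      φ.measurableVersion.toFun ω = φ.toFun ω := by
  have h : ∀ᵐ ω ∂P, ∀ i j k, φ.F i j k ω = φ.measurableVersion.F i j k ω := by
    simp_rw [ae_all_iff]
    exact fun i j k => (φ.F_adapted i j k).ae_eq_mk
  filter_upwards [h] with ω hω
  refine ⟨fun B t => ?_, funext fun z => ?_⟩
  · unfold integral
    simp_rw [hω]
    rfl
  · unfold toFun
    simp_rw [hω]
    rfl

variable [NormedSpace ℝ X] [IsScalarTower ℝ 𝕜 X]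

lemma integral_eq_sum_smul_coeff (B : Set J) (t : ℝ≥0) (ω : Ω) :
    φ.integral B t ω = ∑ i, ∑ j, compensated N (timeProd ν)
      (Set.Ioc (min (φ.t i.castSucc) t) (min (φ.t i.succ) t) ×ˢ (φ.A j ∩ B)) ω •
        φ.coeff i j ω := by
  refine Finset.sum_congr rfl fun i _ => Finset.sum_congr rfl fun j _ => ?_
  rw [coeff, Finset.smul_sum]
  refine Finset.sum_congr rfl fun n _ => ?_
  rw [mul_comm, mul_smul, RCLike.real_smul_eq_coe_smul (K := 𝕜)]

/-- Over one grid step, each interval of the process is active throughout, already finished, or not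
yet started; only an active one changes the integral. -/
lemma integral_grid_succ [SFinite ν] (hB : MeasurableSet B) (h : φ.FiniteAt ω)
    (ht : ∀ i, ∃ q, τ q = φ.t i) (hτ : Monotone τ) (q : ℕ) :
    φ.integral B (τ (q + 1)) ω = φ.integral B (τ q) ω + ∑ j ∈ Finset.range φ.m,
      compensated N (timeProd ν) (φ.cell B (τ q) (τ (q + 1)) j) ω • φ.coeffAt (τ q) j ω := by
  rw [integral_eq_sum_smul_coeff, integral_eq_sum_smul_coeff, Finset.sum_range]
  have hcell : ∀ j : Fin φ.m, compensated N (timeProd ν) (φ.cell B (τ q) (τ (q + 1)) j) ω •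
      φ.coeffAt (τ q) j ω = ∑ i, if φ.t i.castSucc ≤ τ q ∧ τ q < φ.t i.succ then
        compensated N (timeProd ν) (Set.Ioc (τ q) (τ (q + 1)) ×ˢ (φ.A j ∩ B)) ω •
          φ.coeff i j ω else 0 := fun j => by
    rw [cell, coeffAt, dif_pos j.2, dif_pos j.2, Finset.smul_sum]
    simp only [smul_ite, smul_zero]
  simp_rw [hcell]
  rw [Finset.sum_comm (s := (Finset.univ : Finset (Fin φ.m))), ← Finset.sum_add_distrib]
  refine Finset.sum_congr rfl fun i _ => ?_
  rw [← Finset.sum_add_distrib]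
  refine Finset.sum_congr rfl fun j _ => ?_
  have hq : τ q ≤ τ (q + 1) := hτ (Nat.le_succ q)
  have hii : φ.t i.castSucc ≤ φ.t i.succ := φ.t_strictMono.monotone i.castSucc_lt_succ.le
  have hnext : ∀ i', τ q < φ.t i' → τ (q + 1) ≤ φ.t i' := by
    intro i' hi'
    obtain ⟨r, hr⟩ := ht i'
    rw [← hr] at hi' ⊢
    refine hτ ?_
    by_contra hcon
    exact absurd hi' (not_lt.2 (hτ (by omega)))
  by_cases h1 : φ.t i.castSucc ≤ τ q
  · by_cases h2 : τ q < φ.t i.succ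
    · rw [if_pos ⟨h1, h2⟩, min_eq_left h1, min_eq_left (h1.trans hq), min_eq_right h2.le,
        min_eq_right (hnext _ h2),
        φ.compensated_Ioc_add hB h h1 hq ((hnext _ h2).trans (φ.t_le_last _)), add_smul]
    · rw [if_neg (fun h => h2 h.2), add_zero, min_eq_left h1, min_eq_left (h1.trans hq),
        min_eq_left (not_lt.1 h2), min_eq_left ((not_lt.1 h2).trans hq)]
  · have h3 := hnext _ (not_le.1 h1)
    rw [if_neg (fun h => h1 h.1), add_zero, min_eq_right h3, min_eq_right (not_le.1 h1).le,
      min_eq_right (h3.trans hii), min_eq_right ((not_le.1 h1).le.trans hii)]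
    simp [compensated_empty]

lemma integral_zero (B : Set J) (ω : Ω) : φ.integral B 0 ω = 0 := by
  rw [integral_eq_sum_smul_coeff]
  simp [compensated_empty]

lemma integral_grid_eq_transform [SFinite ν] (hB : MeasurableSet B) (h : φ.FiniteAt ω)
    (ht : ∀ i, ∃ q, τ q = φ.t i) (hτ : Monotone τ) (h0 : τ 0 = 0) (q : ℕ) :
    φ.integral B (τ q) ω = transform (fun k => compensated N (timeProd ν) (φ.gridCell B τ k))
      (φ.gridCoeff τ) (q * φ.m) ω := by
  rw [transform]
  simp only [gridCell, gridCoeff]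
  rw [sum_range_mul φ.m (fun r j => compensated N (timeProd ν) (φ.cell B (τ r) (τ (r + 1)) j) ω •
    φ.coeffAt (τ r) j ω)]
  induction q with
  | zero => simp [h0, integral_zero]
  | succ q ih => rw [φ.integral_grid_succ hB h ht hτ, ih, Finset.sum_range_succ]

lemma tendsto_integral [SFinite ν] (hB : MeasurableSet B) (h : φ.FiniteAt ω) {t : ℝ≥0}
    {u : ℕ → ℝ≥0} (hu : Antitone u) (hut : ∀ n, t ≤ u n)
    (hlim : Filter.Tendsto u Filter.atTop (nhds t)) :
    Filter.Tendsto (fun n => φ.integral B (u n) ω) Filter.atTop (nhds (φ.integral B t ω)) := by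
  simp_rw [integral_eq_sum_smul_coeff]
  refine tendsto_finsetSum _ fun i _ => tendsto_finsetSum _ fun j _ =>
    Filter.Tendsto.smul_const ?_ _
  have hii : φ.t i.castSucc ≤ φ.t i.succ := φ.t_strictMono.monotone i.castSucc_lt_succ.le
  -- Both endpoints move with `x`, so the mass is written as a difference of cumulative masses from
  -- time `0`, each right-continuous.
  have key : ∀ x, compensated N (timeProd ν)
      (Set.Ioc (min (φ.t i.castSucc) x) (min (φ.t i.succ) x) ×ˢ (φ.A j ∩ B)) ω =
      compensated N (timeProd ν) (Set.Ioc 0 (min (φ.t i.succ) x) ×ˢ (φ.A j ∩ B)) ω -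
      compensated N (timeProd ν) (Set.Ioc 0 (min (φ.t i.castSucc) x) ×ˢ (φ.A j ∩ B)) ω :=
    fun x => eq_sub_of_add_eq' (φ.compensated_Ioc_add hB h zero_le (min_le_min_right x hii)
      ((min_le_left _ _).trans (φ.t_le_last _)) j).symm
  have hlim' : ∀ i' : Fin (φ.l + 1), Filter.Tendsto (fun n => compensated N (timeProd ν)
      (Set.Ioc 0 (min (φ.t i') (u n)) ×ˢ (φ.A j ∩ B)) ω) Filter.atTop
      (nhds (compensated N (timeProd ν) (Set.Ioc 0 (min (φ.t i') t) ×ˢ (φ.A j ∩ B)) ω)) :=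
    fun i' => (tendsto_measure_Ioc_min_prod (N ω) ((φ.A_measurable j).inter hB)
      (h.ne_top (φ.t_le_last _) j) hu hut hlim).sub
      (tendsto_measure_Ioc_min_prod (timeProd ν) ((φ.A_measurable j).inter hB)
      (φ.timeProd_ne_top _ _ j) hu hut hlim)
  simp_rw [key]
  exact (hlim' _).sub (hlim' _)

lemma aestronglyMeasurable_integral [IsFiniteMeasure P]
    (hN : IsPoissonRandomMeasure N (timeProd ν) P) (hB : MeasurableSet B) (t : ℝ≥0) :
    AEStronglyMeasurable (φ.integral B t) P := by
  have : φ.integral B t = fun ω => ∑ i, ∑ j, compensated N (timeProd ν)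
      (Set.Ioc (min (φ.t i.castSucc) t) (min (φ.t i.succ) t) ×ˢ (φ.A j ∩ B)) ω •
        φ.coeff i j ω := funext fun ω => φ.integral_eq_sum_smul_coeff B t ω
  rw [this]
  refine Finset.aestronglyMeasurable_fun_sum _ fun i _ => Finset.aestronglyMeasurable_fun_sum _
    fun j _ => ?_
  exact (hN.measurable_compensated (measurableSet_Ioc.prod
    ((φ.A_measurable j).inter hB))).aestronglyMeasurable.smul (φ.memLp_coeff i j).1

/-- On finitely many times the stochastic integral is controlled by a transform of independent
noise by an adapted sequence. -/
theorem exists_discretization [IsProbabilityMeasure P] [SFinite ν]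
    (hN : IsPoissonRandomMeasure N (timeProd ν) P) (hB : MeasurableSet B) (S : Finset ℝ≥0) :
    ∃ (𝓖 : Filtration ℕ ‹MeasurableSpace Ω›) (η : ℕ → Ω → ℝ) (ξ : ℕ → Ω → X) (a : ℕ → ℝ≥0) (n : ℕ),
      IsNoise 𝓖 η P ∧ IsBoundedAdapted 𝓖 ξ P ∧
      (∀ r : ℝ, 1 ≤ r → ∀ k, ∫⁻ ω, ‖η k ω‖ₑ ^ r ∂P ≤ poissonMomentBound r * a k) ∧
      ∀ᵐ ω ∂P, (∀ t ∈ S, ‖φ.integral B t ω‖ₑ ≤ maxTransform η ξ n ω) ∧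
        ∀ Ψ : ℝ≥0∞ → ℝ≥0∞, ∑ k ∈ Finset.range n, a k * Ψ ‖ξ k ω‖ₑ ≤
          ∫⁻ z, Ψ ‖restrictJump φ.toFun B ω z‖ₑ ∂(timeProd ν) := by
  let ψ := φ.measurableVersion
  -- This mesh gives every cell intensity at most `1`.
  set δ : ℝ≥0 := (1 + ∑ j, (ν (ψ.A j)).toNNReal)⁻¹
  have hδ0 : 0 < δ := by positivity
  have hδ : ∀ j, δ * ν (ψ.A j) ≤ 1 := by
    intro j
    rw [← ENNReal.coe_toNNReal (ψ.A_finite j).ne, ← ENNReal.coe_mul]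
    refine ENNReal.coe_le_one_iff.2 ?_
    rw [inv_mul_le_one₀ (by positivity)]
    exact (Finset.single_le_sum (f := fun j => (ν (ψ.A j)).toNNReal) (fun _ _ => zero_le)
      (Finset.mem_univ j)).trans le_add_self
  obtain ⟨τ, hτ, h0, hg, hS⟩ := exists_grid (S ∪ Finset.univ.image ψ.t) hδ0
  have ht : ∀ i, ∃ q, τ q = ψ.t i := fun i => hS _ (by simp)
  have hDm : ∀ k, MeasurableSet (ψ.gridCell B τ k) := fun k => ψ.measurableSet_cell hB _ _ _
  have hD1 : ∀ k, timeProd ν (ψ.gridCell B τ k) ≤ 1 := ψ.timeProd_gridCell_le_one hg hδ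
  have hDa : ∀ k, ((timeProd ν (ψ.gridCell B τ k)).toNNReal : ℝ≥0∞) =
      timeProd ν (ψ.gridCell B τ k) := fun k =>
    ENNReal.coe_toNNReal ((hD1 k).trans_lt ENNReal.one_lt_top).ne
  choose! q hq using hS
  refine ⟨pastFiltration hN (ψ.gridCell B τ),
    fun k => compensated N (timeProd ν) (ψ.gridCell B τ k), ψ.gridCoeff τ,
    fun k => (timeProd ν (ψ.gridCell B τ k)).toNNReal, S.sup q * ψ.m,
    isNoise_compensated hN hDm (ψ.disjoint_gridCell hτ) hD1,
    ψ.isBoundedAdapted_gridCoeff hN hτ fun i j k => (φ.F_adapted i j k).stronglyMeasurable_mk,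
    fun r hr k => ?_, ?_⟩
  · rw [hDa]
    exact hN.lintegral_compensated_rpow_le hr (hDm k) (hD1 k)
  · filter_upwards [φ.ae_measurableVersion_eq, ψ.ae_finiteAt hN] with ω hω hfin
    refine ⟨fun t htS => ?_, fun Ψ => ?_⟩
    · rw [← hω.1 B t, ← hq t (Finset.mem_union_left _ htS)]
      rw [ψ.integral_grid_eq_transform hB hfin ht hτ h0, enorm_eq_nnnorm, ENNReal.coe_le_coe]
      exact Finset.le_sup (f := fun i => ‖transform _ _ i ω‖₊) (Finset.mem_range.2
        (Nat.lt_succ_of_le (Nat.mul_le_mul_right _ (Finset.le_sup htS))))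
    · simp_rw [hDa]
      refine (ψ.sum_measure_gridCell_mul_le ht hτ hB Ψ _ ω).trans_eq ?_
      simp only [restrictJump, ψ, hω.2]

/-- The supremum over all times reduces to suprema over finite sets of times. -/
theorem lintegral_iSup_integral_le [IsFiniteMeasure P] [SFinite ν]
    (hN : IsPoissonRandomMeasure N (timeProd ν) P) (hB : MeasurableSet B) {p : ℝ}
    {R : ℝ≥0∞}
    (hR : ∀ S : Finset ℝ≥0, ∫⁻ ω, S.sup (fun t => ‖φ.integral B t ω‖ₑ ^ p) ∂P ≤ R) :
    ∫⁻ ω, ⨆ (t : ℝ≥0) (_ : 0 < t), ‖φ.integral B t ω‖ₑ ^ p ∂P ≤ R := by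
  obtain ⟨D, hDc, hDd⟩ := TopologicalSpace.exists_countable_dense ℝ≥0
  obtain ⟨u, hu⟩ := hDc.exists_eq_range hDd.nonempty
  let f : ℕ → Ω → ℝ≥0∞ := fun n ω => ((Finset.range n).image u).sup
    fun t => ‖φ.integral B t ω‖ₑ ^ p
  have hle : ∀ᵐ ω ∂P, ⨆ (t : ℝ≥0) (_ : 0 < t), ‖φ.integral B t ω‖ₑ ^ p ≤ ⨆ n, f n ω := by
    filter_upwards [φ.ae_finiteAt hN] with ω hω
    refine iSup₂_le fun t _ => ?_
    -- The approximation by `D` is from the right, where the paths are continuous.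
    obtain ⟨v, hv, hvD, hvt⟩ := hDd.exists_seq_strictAnti_tendsto t
    have hlim := (φ.tendsto_integral hB hω hv.antitone (fun n => (hvD n).1.le) hvt).enorm
    refine le_of_tendsto' ((ENNReal.continuous_rpow_const.tendsto _).comp hlim) fun n => ?_
    obtain ⟨r, hr⟩ := hu ▸ (hvD n).2
    refine le_iSup_of_le (r + 1) ?_
    exact Finset.le_sup (f := fun t => ‖φ.integral B t ω‖ₑ ^ p)
      (Finset.mem_image.2 ⟨r, Finset.mem_range.2 (Nat.lt_succ_self r), hr⟩)
  have hfm : ∀ n, AEMeasurable (f n) P := fun n => by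
    simp only [f, Finset.sup_eq_iSup]
    exact AEMeasurable.biSup _ (Finset.countable_toSet _) fun t _ =>
      (φ.aestronglyMeasurable_integral hN hB t).enorm.pow_const p
  calc _ ≤ ∫⁻ ω, ⨆ n, f n ω ∂P := lintegral_mono_ae hle
    _ = ⨆ n, ∫⁻ ω, f n ω ∂P := by
        refine lintegral_iSup' hfm (Filter.Eventually.of_forall fun ω m n hmn => ?_)
        exact Finset.sup_mono (Finset.image_subset_image (Finset.range_mono hmn))
    _ ≤ R := iSup_le fun n => hR _

end SimpleProcess

end PoissonIntegral

namespace PoissonIntegral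

/-! ### Mixed norms and the maximal inequalities -/

section Norms

variable {X : Type u} {Ω : Type v} {J : Type w} [NormedAddCommGroup X] [MeasurableSpace Ω]
  [MeasurableSpace J] {P : Measure Ω} {ν : Measure J} {s p : ℝ} {f : Ω → ℝ≥0 × J → X}

lemma mixedNorm_rpow (hp : 0 < p) (q : ℝ) : mixedNorm P ν q p f ^ p =
    ∫⁻ ω, (∫⁻ z, ‖f ω z‖ₑ ^ q ∂(timeProd ν)) ^ (p / q) ∂P := by
  rw [mixedNorm, ← ENNReal.rpow_mul, one_div_mul_cancel hp.ne', ENNReal.rpow_one]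

lemma mixedNorm_self (hp : 0 < p) :
    mixedNorm P ν p p f = (∫⁻ ω, ∫⁻ z, ‖f ω z‖ₑ ^ p ∂(timeProd ν) ∂P) ^ (1 / p) := by
  simp [mixedNorm, div_self hp.ne']

lemma mixedNorm_congr_ae [SFinite (timeProd ν)] {g : Ω → ℝ≥0 × J → X}
    (h : Function.uncurry f =ᵐ[P.prod (timeProd ν)] Function.uncurry g) (q p : ℝ) :
    mixedNorm P ν q p f = mixedNorm P ν q p g := by
  unfold mixedNorm
  congr 1
  refine lintegral_congr_ae ?_
  filter_upwards [Measure.ae_ae_of_ae_prod h] with ω hω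
  have : ∫⁻ z, ‖f ω z‖ₑ ^ q ∂(timeProd ν) = ∫⁻ z, ‖g ω z‖ₑ ^ q ∂(timeProd ν) := by
    refine lintegral_congr_ae ?_
    filter_upwards [hω] with z hz
    rw [show f ω z = g ω z from hz]
  rw [this]

/-- With equal exponents both summands lie in one `L^p` space over the product, and Minkowski's
inequality applies. -/
lemma mixedNorm_self_le_sumNorm [SFinite (timeProd ν)] (hp : 1 ≤ p) :
    mixedNorm P ν p p f ≤ sumNorm P ν p p f := by
  have hp0 : 0 < p := by linarith
  refine le_iInf fun f₁ => le_iInf fun f₂ => le_iInf fun h₁ => le_iInf fun h₂ => le_iInf fun h => ?_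
  have key : ∀ g : Ω → ℝ≥0 × J → X,
      AEStronglyMeasurable (Function.uncurry g) (P.prod (timeProd ν)) →
      mixedNorm P ν p p g =
        (∫⁻ q, ‖Function.uncurry g q‖ₑ ^ p ∂(P.prod (timeProd ν))) ^ (1 / p) := fun g hg => by
    rw [mixedNorm_self hp0, lintegral_prod _ (hg.enorm.pow_const p)]
    rfl
  rw [key f ((h₁.add h₂).congr h.symm), key f₁ h₁, key f₂ h₂]
  refine le_trans (ENNReal.rpow_le_rpow (lintegral_mono_ae ?_) (by positivity))
    (ENNReal.lintegral_Lp_add_le h₁.enorm h₂.enorm hp)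
  filter_upwards [h] with q hq
  rw [hq]
  exact ENNReal.rpow_le_rpow (enorm_add_le _ _) hp0.le

end Norms

variable {𝕜 : Type k} [RCLike 𝕜] {X : Type u} [NormedAddCommGroup X]
  [NormedSpace ℝ X] [NormedSpace 𝕜 X] [IsScalarTower ℝ 𝕜 X] [CompleteSpace X]
  {s p : ℝ} {C : ℝ≥0} {Ω : Type v} {J : Type w} [MeasurableSpace Ω] [MeasurableSpace J]
  {P : Measure Ω} [IsProbabilityMeasure P] {ν : Measure J} [SFinite ν]
  {N : Ω → Measure (ℝ≥0 × J)} {B : Set J}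

lemma sup_rpow_le {S : Finset ℝ≥0} {g : ℝ≥0 → ℝ≥0∞} {x : ℝ≥0∞} (hp : 0 ≤ p)
    (h : ∀ t ∈ S, g t ≤ x) : S.sup (fun t => g t ^ p) ≤ x ^ p :=
  Finset.sup_le fun t ht => ENNReal.rpow_le_rpow (h t ht) hp

/-- The maximal inequality for the stochastic integral, Rosenthal type. -/
theorem lintegral_iSup_integral_rpow_le (hs : 1 < s) (hp : 1 ≤ p)
    (hC : MartingaleTypeBound.{v, u} X s C) (hN : IsPoissonRandomMeasure N (timeProd ν) P)
    (φ : SimpleProcess 𝕜 X P ν N) (hB : MeasurableSet B) {δ : ℝ≥0} (hδ0 : 0 < δ)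
    (hδ : 2 * 3 ^ p * (C ^ s * poissonMomentBound s * δ ^ s) ≤ 1) :
    ∫⁻ ω, ⨆ (t : ℝ≥0) (_ : 0 < t), ‖φ.integral B t ω‖ₑ ^ p ∂P ≤
      (2 * 3 ^ p * (poissonMomentBound p + δ⁻¹ ^ p) : ℝ≥0) *
        interNorm P ν s p (restrictJump φ.toFun B) ^ p := by
  have hp0 : 0 < p := by linarith
  have hs0 : 0 < s := by linarith
  refine φ.lintegral_iSup_integral_le hN hB fun S => ?_
  obtain ⟨𝓖, η, ξ, a, n, hη, hξ, ha, hae⟩ := φ.exists_discretization hN hB S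
  have h := lintegral_maxTransform_rpow_le hs hp0 hC hη hξ (ha s hs.le) (ha p hp) n hδ0 hδ
  set I := interNorm P ν s p (restrictJump φ.toFun B)
  have h1 : ∫⁻ ω, ∑ k ∈ Finset.range n, a k * ‖ξ k ω‖ₑ ^ p ∂P ≤ I ^ p := by
    refine le_trans ?_ (ENNReal.rpow_le_rpow (le_max_right _ _) hp0.le)
    rw [mixedNorm_rpow hp0, div_self hp0.ne']
    simp_rw [ENNReal.rpow_one]
    exact lintegral_mono_ae (hae.mono fun ω hω => hω.2 fun x => x ^ p)
  have h2 : ∫⁻ ω, (∑ k ∈ Finset.range n, a k * ‖ξ k ω‖ₑ ^ s) ^ (p / s) ∂P ≤ I ^ p := by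
    refine le_trans ?_ (ENNReal.rpow_le_rpow (le_max_left _ _) hp0.le)
    rw [mixedNorm_rpow hp0]
    exact lintegral_mono_ae (hae.mono fun ω hω =>
      ENNReal.rpow_le_rpow (hω.2 fun x => x ^ s) (by positivity))
  calc ∫⁻ ω, S.sup (fun t => ‖φ.integral B t ω‖ₑ ^ p) ∂P
      ≤ ∫⁻ ω, (maxTransform η ξ n ω : ℝ≥0∞) ^ p ∂P :=
        lintegral_mono_ae (hae.mono fun ω hω => sup_rpow_le hp0.le hω.1)
    _ ≤ _ := h
    _ ≤ (2 * 3 ^ p : ℝ≥0) * (poissonMomentBound p * I ^ p + (δ⁻¹ ^ p : ℝ≥0) * I ^ p) := by gcongr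
    _ = _ := by
        rw [ENNReal.coe_mul _ (poissonMomentBound p + δ⁻¹ ^ p), ENNReal.coe_add]
        ring

/-- The maximal inequality for the stochastic integral for small exponents. -/
theorem lintegral_iSup_integral_rpow_le_of_lt (hs : 1 < s) (hp : 1 < p) (hps : p < s)
    (hC : MartingaleTypeBound.{v, u} X s C) (hN : IsPoissonRandomMeasure N (timeProd ν) P)
    (φ : SimpleProcess 𝕜 X P ν N) (hB : MeasurableSet B) {f₁ f₂ : Ω → ℝ≥0 × J → X}
    (h₁ : AEStronglyMeasurable (Function.uncurry f₁) (P.prod (timeProd ν)))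
    (h₂ : AEStronglyMeasurable (Function.uncurry f₂) (P.prod (timeProd ν)))
    (h : Function.uncurry (restrictJump φ.toFun B) =ᵐ[P.prod (timeProd ν)]
      Function.uncurry f₁ + Function.uncurry f₂) :
    ∫⁻ ω, ⨆ (t : ℝ≥0) (_ : 0 < t), ‖φ.integral B t ω‖ₑ ^ p ∂P ≤
      (2 ^ p * p.toNNReal * (1 + C ^ s * poissonMomentBound s + poissonMomentBound 1) *
        (2 ^ s * (1 / (p - 1) + 1 / (s - p)).toNNReal) : ℝ≥0) *
        (mixedNorm P ν s p f₁ ^ p + mixedNorm P ν p p f₂ ^ p) := by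
  have hp0 : 0 < p := by linarith
  have hs0 : 0 < s := by linarith
  have := hN.sigmaFinite
  refine φ.lintegral_iSup_integral_le hN hB fun S => ?_
  obtain ⟨𝓖, η, ξ, a, n, hη, hξ, ha, hae⟩ := φ.exists_discretization hN hB S
  have hmax := lintegral_maxTransform_rpow_le_lintegral_minPow hs hp0 hC hη hξ (ha s hs.le)
    (by simpa using ha 1 le_rfl) n
  -- Jointly measurable versions of the summands are needed for Tonelli; the mixed norms are
  -- unaffected.
  let g₁ : Ω → ℝ≥0 × J → X := fun ω z => h₁.mk _ (ω, z)
  let g₂ : Ω → ℝ≥0 × J → X := fun ω z => h₂.mk _ (ω, z)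
  have hbound := lintegral_min_one_lintegral_minPow_le (P := P) (μ := timeProd ν) hp hps
    (f := fun ω z => ‖restrictJump φ.toFun B ω z‖ₑ)
    h₁.stronglyMeasurable_mk.enorm h₂.stronglyMeasurable_mk.enorm (by
      have hae : ∀ᵐ q ∂(P.prod (timeProd ν)), ‖restrictJump φ.toFun B q.1 q.2‖ₑ ≤
          ‖h₁.mk _ q‖ₑ + ‖h₂.mk _ q‖ₑ := by
        filter_upwards [h, h₁.ae_eq_mk, h₂.ae_eq_mk] with q hq hq₁ hq₂
        rw [← hq₁, ← hq₂]
        exact le_of_eq_of_le (congrArg (‖·‖ₑ) hq) (enorm_add_le _ _)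
      exact Measure.ae_ae_of_ae_prod hae)
  have e₁ : mixedNorm P ν s p f₁ ^ p =
      ∫⁻ ω, (∫⁻ z, ‖h₁.mk _ (ω, z)‖ₑ ^ s ∂(timeProd ν)) ^ (p / s) ∂P := by
    rw [mixedNorm_congr_ae (g := g₁) h₁.ae_eq_mk, mixedNorm_rpow hp0]
  have e₂ : mixedNorm P ν p p f₂ ^ p =
      ∫⁻ ω, ∫⁻ z, ‖h₂.mk _ (ω, z)‖ₑ ^ p ∂(timeProd ν) ∂P := by
    rw [mixedNorm_congr_ae (g := g₂) h₂.ae_eq_mk, mixedNorm_rpow hp0, div_self hp0.ne']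
    simp_rw [ENNReal.rpow_one]
    rfl
  rw [← e₁, ← e₂] at hbound
  calc ∫⁻ ω, S.sup (fun t => ‖φ.integral B t ω‖ₑ ^ p) ∂P
      ≤ ∫⁻ ω, (maxTransform η ξ n ω : ℝ≥0∞) ^ p ∂P :=
        lintegral_mono_ae (hae.mono fun ω hω => sup_rpow_le hp0.le hω.1)
    _ ≤ _ := hmax
    _ ≤ (2 ^ p * p.toNNReal * (1 + C ^ s * poissonMomentBound s + poissonMomentBound 1) : ℝ≥0) *
        ∫⁻ t in Set.Ioi (0 : ℝ), (∫⁻ ω, min 1 (∫⁻ z, minPow s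
          (‖restrictJump φ.toFun B ω z‖ₑ / ENNReal.ofReal t) ∂(timeProd ν)) ∂P) *
            ENNReal.ofReal (t ^ (p - 1)) := by
        refine mul_le_mul_right (lintegral_mono fun t => mul_le_mul_left ?_ _) _
        exact lintegral_mono_ae (hae.mono fun ω hω =>
          min_le_min le_rfl (hω.2 fun x => minPow s (x / ENNReal.ofReal t)))
    _ ≤ _ := mul_le_mul_right hbound _
    _ = _ := by
        rw [← mul_assoc]
        congr 1
        rw [ENNReal.coe_mul _ (2 ^ s * _), ENNReal.coe_mul (2 ^ s),
          ENNReal.coe_rpow_of_nonneg _ hs0.le]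
        rfl

end PoissonIntegral

/-! ### The main theorem -/

theorem mainTheorem1 (𝕜 : Type k) [RCLike 𝕜] (X : Type u) [NormedAddCommGroup X]
    [NormedSpace ℝ X] [NormedSpace 𝕜 X] [IsScalarTower ℝ 𝕜 X] [CompleteSpace X]
    (s : ℝ) (hs : 1 < s) (hs2 : s ≤ 2) (hX : PoissonIntegral.HasMartingaleType.{v, u} X s)
    (p : ℝ) :
    (s ≤ p → ∃ C : ℝ≥0, ∀ (Ω : Type v) (J : Type w) [MeasurableSpace Ω] [MeasurableSpace J]
      (P : Measure Ω) [IsProbabilityMeasure P] (ν : Measure J) [SigmaFinite ν]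
      (N : Ω → Measure (ℝ≥0 × J)),
      PoissonIntegral.IsPoissonRandomMeasure N (PoissonIntegral.timeProd ν) P →
      ∀ (φ : PoissonIntegral.SimpleProcess 𝕜 X P ν N) (B : Set J), MeasurableSet B →
        (∫⁻ ω, ⨆ (t : ℝ≥0) (_ : 0 < t), ‖φ.integral B t ω‖ₑ ^ p ∂P) ^ (1 / p) ≤
          C * PoissonIntegral.interNorm P ν s p (PoissonIntegral.restrictJump φ.toFun B)) ∧
    (1 < p → p ≤ s → ∃ C : ℝ≥0, ∀ (Ω : Type v) (J : Type w) [MeasurableSpace Ω]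
      [MeasurableSpace J] (P : Measure Ω) [IsProbabilityMeasure P] (ν : Measure J) [SigmaFinite ν]
      (N : Ω → Measure (ℝ≥0 × J)),
      PoissonIntegral.IsPoissonRandomMeasure N (PoissonIntegral.timeProd ν) P →
      ∀ (φ : PoissonIntegral.SimpleProcess 𝕜 X P ν N) (B : Set J), MeasurableSet B →
        (∫⁻ ω, ⨆ (t : ℝ≥0) (_ : 0 < t), ‖φ.integral B t ω‖ₑ ^ p ∂P) ^ (1 / p) ≤
          C * PoissonIntegral.sumNorm P ν s p (PoissonIntegral.restrictJump φ.toFun B)) := by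
  obtain ⟨C, hC⟩ := hX
  replace hC : PoissonIntegral.MartingaleTypeBound.{v, u} X s C := hC
  have hs0 : 0 < s := by linarith
  have large : ∀ p : ℝ, s ≤ p → ∃ C : ℝ≥0, ∀ (Ω : Type v) (J : Type w) [MeasurableSpace Ω]
      [MeasurableSpace J] (P : Measure Ω) [IsProbabilityMeasure P] (ν : Measure J) [SigmaFinite ν]
      (N : Ω → Measure (ℝ≥0 × J)),
      PoissonIntegral.IsPoissonRandomMeasure N (PoissonIntegral.timeProd ν) P →
      ∀ (φ : PoissonIntegral.SimpleProcess 𝕜 X P ν N) (B : Set J), MeasurableSet B →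
        (∫⁻ ω, ⨆ (t : ℝ≥0) (_ : 0 < t), ‖φ.integral B t ω‖ₑ ^ p ∂P) ^ (1 / p) ≤
          C * PoissonIntegral.interNorm P ν s p (PoissonIntegral.restrictJump φ.toFun B) := by
    intro p hp
    have hp0 : 0 < p := by linarith
    set D : ℝ≥0 := 2 * 3 ^ p * (C ^ s * PoissonIntegral.poissonMomentBound s) with hD
    -- Then `D * δ ^ s = D / (D + 1) ≤ 1`, as the absorption requires.
    set δ : ℝ≥0 := ((D + 1)⁻¹) ^ (1 / s) with hδ
    have hδ1 : 2 * 3 ^ p * (C ^ s * PoissonIntegral.poissonMomentBound s * δ ^ s) ≤ 1 := by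
      rw [← mul_assoc, ← hD, hδ, ← NNReal.rpow_mul, one_div_mul_cancel hs0.ne', NNReal.rpow_one,
        ← div_eq_mul_inv, div_le_one (by positivity)]
      exact le_self_add
    refine ⟨(2 * 3 ^ p * (PoissonIntegral.poissonMomentBound p + δ⁻¹ ^ p)) ^ (1 / p), ?_⟩
    intro Ω J _ _ P _ ν _ N hN φ B hB
    have h := PoissonIntegral.lintegral_iSup_integral_rpow_le hs (by linarith) hC hN φ hB
      (by positivity) hδ1
    refine (ENNReal.rpow_le_rpow h (by positivity : 0 ≤ 1 / p)).trans_eq ?_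
    rw [ENNReal.mul_rpow_of_nonneg _ _ (by positivity), ← ENNReal.rpow_mul,
      mul_one_div_cancel hp0.ne', ENNReal.rpow_one, ENNReal.coe_rpow_of_nonneg _ (by positivity)]
  refine ⟨large p, fun hp hps => ?_⟩
  -- The constant `1 / (s - p)` degenerates at `p = s`, so the endpoint is taken from `large`.
  rcases hps.eq_or_lt with rfl | hps
  · obtain ⟨C', hC'⟩ := large p le_rfl
    refine ⟨C', fun Ω J _ _ P _ ν _ N hN φ B hB => (hC' Ω J P ν N hN φ B hB).trans ?_⟩
    have := hN.sigmaFinite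
    rw [PoissonIntegral.interNorm, max_self]
    exact mul_le_mul_right (PoissonIntegral.mixedNorm_self_le_sumNorm hp.le) _
  · have hp0 : 0 < p := by linarith
    set L : ℝ≥0 := 2 ^ p * p.toNNReal * (1 + C ^ s * PoissonIntegral.poissonMomentBound s +
      PoissonIntegral.poissonMomentBound 1) * (2 ^ s * (1 / (p - 1) + 1 / (s - p)).toNNReal)
    refine ⟨L ^ (1 / p), fun Ω J _ _ P _ ν _ N hN φ B hB => ?_⟩
    have hL : ((L ^ (1 / p) : ℝ≥0) : ℝ≥0∞) = (L : ℝ≥0∞) ^ (1 / p) :=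
      ENNReal.coe_rpow_of_nonneg _ (by positivity)
    have hp' : 0 < p.toNNReal := Real.toNNReal_pos.2 hp0
    have hκ : 0 < (1 / (p - 1) + 1 / (s - p)).toNNReal := Real.toNNReal_pos.2
      (add_pos (one_div_pos.2 (by linarith)) (one_div_pos.2 (by linarith)))
    have hL0 : ((L ^ (1 / p) : ℝ≥0) : ℝ≥0∞) ≠ 0 := ENNReal.coe_ne_zero.2 (by positivity)
    -- Dividing by the nonzero constant isolates the infimum, so each decomposition can be treated
    -- separately.
    rw [← ENNReal.div_le_iff' hL0 ENNReal.coe_ne_top]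
    refine le_iInf fun f₁ => le_iInf fun f₂ => le_iInf fun h₁ => le_iInf fun h₂ =>
      le_iInf fun h => ?_
    rw [ENNReal.div_le_iff' hL0 ENNReal.coe_ne_top, hL]
    have hbound := PoissonIntegral.lintegral_iSup_integral_rpow_le_of_lt hs hp hps hC hN φ hB
      h₁ h₂ h
    refine (ENNReal.rpow_le_rpow hbound (by positivity : 0 ≤ 1 / p)).trans ?_
    rw [ENNReal.mul_rpow_of_nonneg _ _ (by positivity)]
    -- Subadditivity of `x ↦ x^(1/p)`, valid since `p ≥ 1`, turns the sum of `p`-th powers into the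
    -- sum of norms.
    refine mul_le_mul_right ((ENNReal.rpow_add_le_add_rpow _ _ (by positivity)
      ((div_le_one hp0).2 hp.le)).trans_eq ?_) _
    rw [← ENNReal.rpow_mul, ← ENNReal.rpow_mul, mul_one_div_cancel hp0.ne', ENNReal.rpow_one,
      ENNReal.rpow_one]
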